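/- Notation. For a function $a$ on $\mathbb R^3$ put $\hat a(\xi)=\int_{\mathbb R^3}e^{-\mathrm i x\cdot\xi}a(x)\,dx$, entrywise for matrices. A symbol of order $r$ is a function $\sigma\in C^\infty(\mathbb R^3\times\mathbb R^3)$ with $|\partial_\xi^{\alpha}\partial_x^{\beta}\sigma(x,\xi)|\le C_{\alpha,\beta}(1+|\xi|)^{r-|\alpha|}$ for all multi-indices $\alpha,\beta$ and all $x,\xi$. Pairings are bilinear, $\langle u,\varphi\rangle=\int u\cdot\varphi$. Source. Let $D\subset\mathbb R^3$ be open and bounded, $m\in(-1,3]$, and let $f$ be a centered $\mathbb C^3$-valued generalized Gaussian random field on $\mathbb R^3$ over a probability space: every path of $f$ is a $\mathbb C^3$-valued distribution, and for every test function $\psi\in C_0^\infty(\mathbb R^3;\mathbb C^3)$ the variable $\langle f,\psi\rangle$ is complex Gaussian (its real and imaginary parts are jointly Gaussian) with mean $0$. Assume that $f$ is microlocally isotropic of order $-m$ in $D$ with strengths $A^c,A^r\in C_0^\infty(D;\mathbb C^{3\times3})$, i.e. for $\eta\in\{c,r\}$ there are matrix symbols $\Sigma^\eta$ of order $-m$ and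 $B^\eta$ of order $-m-1$, with $\Sigma^\eta(\cdot,\xi),B^\eta(\cdot,\xi)\in C_0^\infty(D;\mathbb C^{3\times 3})$ for every $\xi$ and $$\Sigma^\eta(x,\xi)=A^\eta(x)|\xi|^{-m}+B^\eta(x,\xi)\qquad(|\xi|\ge1),$$ such that for all test functions $\varphi,\psi$ $$\mathbb E\big[\langle\bar f,\varphi\rangle\langle f,\psi\rangle\big]=\int(\mathcal C\varphi)\cdot\psi\,dx,\qquad \mathbb E\big[\langle f,\varphi\rangle\langle f,\psi\rangle\big]=\int(\mathcal R\varphi)\cdot\psi\,dx,$$ where $\mathcal C\varphi(x)=(2\pi)^{-3}\int e^{\mathrm i x\cdot\xi}\Sigma^c(x,\xi)\hat\varphi(\xi)\,d\xi$, and $\mathcal R$ is defined in the same way with $\Sigma^r$. Fields. Let $\kappa>0$ be the wave number and let $$E(x,\kappa)=\mathrm i\kappa\int\Phi(x,y,\kappa)f(y)\,dy,\qquad \Phi(x,y,\kappa)=\frac{e^{\mathrm i\kappa|x-y|}}{4\pi|x-y|},$$ be the electric field radiated by the current density $f$, and $$E^\infty(\hat x,\kappa)=\frac{\mathrm i\kappa}{4\pi}\int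 e^{-\mathrm i\kappa\hat x\cdot y}f(y)\,dy,\qquad \hat x\in\mathbb S^2 .$$ (When $f$ is weakly divergence-free, $E$ is the outgoing electric field of Maxwell's equations $\nabla\times E-\mathrm i\kappa H=0$, $\nabla\times H+\mathrm i\kappa E=f$. The statements below do not need this condition.) The integrals against $f$ are the pairings of $f$ with the kernel times an arbitrary fixed cut-off $\chi\in C_0^\infty(\mathbb R^3)$ that equals $1$ in a neighbourhood of $\overline D$; $E$ is considered for $x$ outside the support of $\chi$. Theorem. (i) $E^\infty$ is the far-field pattern of $E$: for every realization, every $\kappa>0$ and every $\hat x\in\mathbb S^2$, $r\,e^{-\mathrm i\kappa r}E(r\hat x,\kappa)\to E^\infty(\hat x,\kappa)$ as $r\to\infty$. (ii) For all $\hat x\in\mathbb S^2$ and $\tau\ge0$, it holds almost surely that $$\lim_{Q\to\infty}\frac1Q\int_Q^{2Q}\kappa^{m-2}E^\infty(\hat x,\kappa+\tau)\overline{E^\infty(\hat x,\kappa)}^{\top}d\kappa=\frac1{16\pi^2}\widehat{A^c}(\tau\hat x),\tag{1}$$ $$\lim_{Q\to\infty}\frac1Q\int_Q^{2Q}\kappa^{m-2}E^\infty(\hat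 x,\kappa+\tau)E^\infty(-\hat x,\kappa)^{\top}d\kappa=-\frac1{16\pi^2}\widehat{A^r}(\tau\hat x).\tag{2}$$ (iii) $A^c$ and $A^r$ are uniquely determined by (1) and (2), respectively, with $(\tau,\hat x)$ in any nonempty open set $\Theta\subset[0,\infty)\times\mathbb S^2$: if $B\in C_0^\infty(\mathbb R^3;\mathbb C^{3\times3})$ and if for each $(\tau,\hat x)\in\Theta$ relation (1) with $B$ in place of $A^c$ holds almost surely, then $B=A^c$; likewise with (2) and $A^r$. This also holds for a single realization: almost surely, for every $B\in C_0^\infty(\mathbb R^3;\mathbb C^{3\times3})$, if (1) with $B$ in place of $A^c$ holds for all $(\tau,\hat x)\in\Theta$, then $B=A^c$; likewise with (2) and $A^r$. -/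

import Mathlib

open MeasureTheory ProbabilityTheory Filter Topology Set
open scoped Distributions ContDiff ComplexConjugate NNReal

noncomputable section

namespace EMSource

/-- Physical space. -/
abbrev E3 : Type := EuclideanSpace ℝ (Fin 3)

/-- The space of `ℂ³`-valued test functions on the whole space. -/
abbrev VecTest : Type := 𝓓((⊤ : TopologicalSpace.Opens E3), Fin 3 → ℂ)

/-- The space of `ℂ³`-valued distributions: the dual of the space of `ℂ³`-valued test functions,
for the bilinear pairing `⟨u, φ⟩ = ∫ u · φ`. -/
abbrev VecDist : Type := VecTest →L[ℂ] ℂ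

/-- Matrix fields. -/
abbrev MatField : Type := E3 → Matrix (Fin 3) (Fin 3) ℂ

/-- Smooth functions with compact support contained in `D`. -/
def IsTestOn (D : Set E3) (a : E3 → ℂ) : Prop :=
  ContDiff ℝ ∞ a ∧ HasCompactSupport a ∧ tsupport a ⊆ D

/-- Matrix fields whose entries are smooth with compact support contained in `D`. -/
def IsTestMatOn (D : Set E3) (A : MatField) : Prop :=
  ∀ j l, IsTestOn D (fun x => A x j l)

/-- The Fourier transform `∫ e^{-i x·ξ} a(x) dx`. -/
def fourier (a : E3 → ℂ) (ξ : E3) : ℂ :=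
  ∫ x, Complex.exp (-(Complex.I * (inner ℝ x ξ : ℝ))) * a x

/-- Symbols of order `r`: smooth functions `σ(x, ξ)` such that every mixed derivative of order
`p` in `x` and `q` in `ξ` is bounded by a constant times `(1 + |ξ|)^(r - q)`. -/
def IsSymbol (r : ℝ) (σ : E3 → E3 → ℂ) : Prop :=
  ContDiff ℝ ∞ (fun z : E3 × E3 => σ z.1 z.2) ∧
  ∀ p q : ℕ, ∃ C : ℝ, ∀ x ξ : E3,
    ‖iteratedFDeriv ℝ q (fun η => iteratedFDeriv ℝ p (fun y => σ y η) x) ξ‖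
      ≤ C * (1 + ‖ξ‖) ^ (r - q)

/-- `S` is a matrix symbol of order `-m` which is supported in `D` in the variable `x` and has the
isotropic principal part `A(x)|ξ|^{-m}`. As usual, the splitting into the principal part and
a remainder `R` of order `-m - 1` is required away from the frequency `ξ = 0`, where `|ξ|^{-m}` is in
general not smooth. -/
def IsIsotropicSymbol (D : Set E3) (m : ℝ) (S : E3 → E3 → Matrix (Fin 3) (Fin 3) ℂ)
    (A : MatField) : Prop :=
  IsTestMatOn D A ∧
  (∀ j l, IsSymbol (-m) (fun x ξ => S x ξ j l)) ∧
  (∀ ξ, IsTestMatOn D (fun x => S x ξ)) ∧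
  ∃ R : E3 → E3 → Matrix (Fin 3) (Fin 3) ℂ,
    (∀ j l, IsSymbol (-m - 1) (fun x ξ => R x ξ j l)) ∧
    (∀ ξ, IsTestMatOn D (fun x => R x ξ)) ∧
    ∀ x ξ, 1 ≤ ‖ξ‖ → S x ξ = ((‖ξ‖ ^ (-m) : ℝ) : ℂ) • A x + R x ξ

/-- The pseudo-differential operator with matrix symbol `S`. -/
def pseudoDiff (S : E3 → E3 → Matrix (Fin 3) (Fin 3) ℂ) (φ : E3 → Fin 3 → ℂ)
    (x : E3) (j : Fin 3) : ℂ :=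
  ((1 / (2 * Real.pi) ^ 3 : ℝ) : ℂ) *
    ∫ ξ, Complex.exp (Complex.I * (inner ℝ x ξ : ℝ)) *
      ∑ l, S x ξ j l * fourier (fun y => φ y l) ξ

/-- The complex conjugate of a test function. -/
def conjTest (φ : VecTest) : VecTest :=
  TestFunction.postcompCLM ((starL' ℝ : (Fin 3 → ℂ) ≃L[ℝ] (Fin 3 → ℂ)) :
    (Fin 3 → ℂ) →L[ℝ] (Fin 3 → ℂ)) φ

theorem conjTest_apply (φ : VecTest) (x : E3) (j : Fin 3) :
    conjTest φ x j = conj (φ x j) := rfl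

section Random

variable {Ω : Type*} [MeasurableSpace Ω]

/-- The covariance form `⟨C_f φ, ψ⟩ = 𝔼[⟨f̄, φ⟩ ⟨f, ψ⟩]` of a centered random distribution, where
`⟨f̄, φ⟩` is the conjugate of `⟨f, φ̄⟩`. -/
def covForm (P : Measure Ω) (f : Ω → VecDist) (φ ψ : VecTest) : ℂ :=
  ∫ s, conj (f s (conjTest φ)) * f s ψ ∂P

/-- The relation form `⟨R_f φ, ψ⟩ = 𝔼[⟨f, φ⟩ ⟨f, ψ⟩]` of a centered random distribution. -/
def relForm (P : Measure Ω) (f : Ω → VecDist) (φ ψ : VecTest) : ℂ :=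
  ∫ s, f s φ * f s ψ ∂P

/-- `f` is a centered `ℂ³`-valued generalized microlocally isotropic Gaussian random field of order
`-m` in `D`; its covariance and relation operators are pseudo-differential operators whose symbols
have the principal parts `Ac(x)|ξ|^{-m}` and `Ar(x)|ξ|^{-m}`. -/
structure IsCenteredGMIG (P : Measure Ω) (D : Set E3) (m : ℝ) (f : Ω → VecDist)
    (Ac Ar : MatField) : Prop where
  gaussian : ∀ ψ : VecTest, HasGaussianLaw (fun s => f s ψ) P
  centered : ∀ ψ : VecTest, ∫ s, f s ψ ∂P = 0
  covariance : ∃ S, IsIsotropicSymbol D m S Ac ∧ ∀ φ ψ : VecTest,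
    covForm P f φ ψ = ∫ x, ∑ j, pseudoDiff S φ x j * ψ x j
  relation : ∃ S, IsIsotropicSymbol D m S Ar ∧ ∀ φ ψ : VecTest,
    relForm P f φ ψ = ∫ x, ∑ j, pseudoDiff S φ x j * ψ x j

end Random

/-- Cut-off functions for `D`: smooth, compactly supported, and equal to `1` in a neighbourhood of
the closure of `D`. -/
def IsCutoff (D : Set E3) (χ : E3 → ℂ) : Prop :=
  ContDiff ℝ ∞ χ ∧ HasCompactSupport χ ∧ ∀ᶠ x in 𝓝ˢ (closure D), χ x = 1

open Classical in
/-- A smooth compactly supported function as a test function (zero if the function is not smooth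
with compact support). -/
def toTest (g : E3 → Fin 3 → ℂ) : VecTest :=
  if h : ContDiff ℝ ∞ g ∧ HasCompactSupport g then
    { toFun := g
      contDiff' := h.1
      hasCompactSupport' := h.2
      tsupport_subset' := fun _ _ => trivial }
  else 0

/-- `∫ g(y) u_j(y) dy` for a distribution `u` that is supported in the closure of `D` and a function
`g` that is smooth on the support of the cut-off `χ` for `D`: the pairing of the `j`-th component of
`u` with `χ g`. -/
def pair (χ : E3 → ℂ) (u : VecDist) (g : E3 → ℂ) (j : Fin 3) : ℂ :=
  u (toTest fun y => Pi.single j (χ y * g y))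

/-- The outgoing fundamental solution of the Helmholtz equation. -/
def Phi (κ : ℝ) (x y : E3) : ℂ :=
  Complex.exp (Complex.I * κ * ‖x - y‖) / (4 * Real.pi * ‖x - y‖)

/-- The electric field `E(x, κ) = iκ ∫ Φ(x, y, κ) u(y) dy` radiated by the current `u`, at points
`x` outside the support of `χ`. -/
def electricField (χ : E3 → ℂ) (u : VecDist) (κ : ℝ) (x : E3) (j : Fin 3) : ℂ :=
  Complex.I * κ * pair χ u (fun y => Phi κ x y) j

/-- The electric far-field pattern
`E^∞(x̂, κ) = iκ (4π)⁻¹ ∫ e^{-iκ x̂·y} u(y) dy`. -/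
def farField (χ : E3 → ℂ) (u : VecDist) (x : E3) (κ : ℝ) (j : Fin 3) : ℂ :=
  Complex.I * κ * (1 / (4 * Real.pi)) *
    pair χ u (fun y => Complex.exp (-(Complex.I * κ * (inner ℝ x y : ℝ)))) j

/-- The frequency averages of `κ^{m-2} E^∞(x̂, κ+τ) \overline{E^∞(x̂, κ)}^⊤` over `[Q, 2Q]` converge,
as `Q → ∞`, to `(16π²)⁻¹ Â(τ x̂)`. -/
def CovAverageTendsto (χ : E3 → ℂ) (m : ℝ) (u : VecDist) (τ : ℝ) (x : E3) (A : MatField) : Prop :=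
  ∀ j l, Tendsto (fun Q : ℝ => ((1 / Q : ℝ) : ℂ) * ∫ κ in Q..(2 * Q),
      ((κ ^ (m - 2) : ℝ) : ℂ) * (farField χ u x (κ + τ) j * conj (farField χ u x κ l)))
    atTop (𝓝 (1 / (16 * Real.pi ^ 2) * fourier (fun y => A y j l) (τ • x)))

/-- The frequency averages of `κ^{m-2} E^∞(x̂, κ+τ) E^∞(-x̂, κ)^⊤` over `[Q, 2Q]` converge,
as `Q → ∞`, to `-(16π²)⁻¹ Â(τ x̂)`. -/
def RelAverageTendsto (χ : E3 → ℂ) (m : ℝ) (u : VecDist) (τ : ℝ) (x : E3) (A : MatField) : Prop :=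
  ∀ j l, Tendsto (fun Q : ℝ => ((1 / Q : ℝ) : ℂ) * ∫ κ in Q..(2 * Q),
      ((κ ^ (m - 2) : ℝ) : ℂ) * (farField χ u x (κ + τ) j * farField χ u (-x) κ l))
    atTop (𝓝 (-(1 / (16 * Real.pi ^ 2)) * fourier (fun y => A y j l) (τ • x)))

end EMSource

end

noncomputable section

namespace EMSource

/-! Far field. In the variable ρ = 1/r the kernel r e^{-iκr} Φ(r x̂, y) is smooth up to ρ = 0, with
value e^{-iκ x̂·y}/(4π) there. A distribution is continuous along smooth families of test functions
with supports in a common compact set (`continuous_toTest`), so the pairing may be evaluated at ρ =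
0 (`tendsto_electricField`).

Averages. Up to the factor iκ/(4π), the far field is the value of f on the cut-off plane wave `wave
χ (κ • x) j`, so it is a centered Gaussian process in κ. Its second moments are the oscillatory
integrals `kern`. They decay rapidly off the diagonal (`exists_kern_le`), and at frequencies
((κ+τ)x̂, κx̂) they equal κ^{-m} Â(τx̂) to leading order (`tendsto_kern`). This makes the
expectation of the averages converge. For the fluctuations, the Wick formula (`wick_complex`) writes
the covariance of a product of two such processes through pair correlations, all of which decay in
|κ - κ'|. A strong law of large numbers (`ae_tendsto_average`) then sends the averaged fluctuations
to zero almost surely; `ae_tendsto_gaussian_average` combines both halves.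

Uniqueness. The limits give Â on an open set of polar coordinates. The Fourier transform of a
compactly supported function is entire along complex lines, so it is determined by these values
(`eq_zero_of_fourier_eq_zero_polar`). Since it is also continuous, a countable dense set of (τ, x̂)
suffices, and one null set then serves all parameters and all candidate strengths. -/

/-! ### Distributions applied to smooth families of test functions. -/

theorem continuous_iteratedFDeriv_slice {G F : Type*} [NormedAddCommGroup G] [NormedSpace ℝ G]
    [NormedAddCommGroup F] [NormedSpace ℝ F] {H : ℝ → G → F}
    (hH : ContDiff ℝ ∞ (Function.uncurry H)) (i : ℕ) :
    Continuous (fun z : ℝ × G => iteratedFDeriv ℝ i (H z.1) z.2) := by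
  -- Derivatives in the second variable alone are the full derivatives of the uncurried map,
  -- precomposed with the inclusion y ↦ (0, y).
  have key : ∀ z : ℝ × G, iteratedFDeriv ℝ i (H z.1) z.2 =
      ContinuousMultilinearMap.compContinuousLinearMapL (fun _ => ContinuousLinearMap.inr ℝ ℝ G)
        (iteratedFDeriv ℝ i (Function.uncurry H) z) := by
    rintro ⟨ρ, y⟩
    have h1 : H ρ = (fun z : ℝ × G => Function.uncurry H (z + (ρ, 0))) ∘
        (ContinuousLinearMap.inr ℝ ℝ G) := by
      ext y; simp
    have h2 : ContDiff ℝ ∞ (fun z : ℝ × G => Function.uncurry H (z + (ρ, 0))) :=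
      hH.comp (contDiff_id.add contDiff_const)
    simp only
    rw [h1, ContinuousLinearMap.iteratedFDeriv_comp_right _ h2 y (by exact_mod_cast le_top),
      iteratedFDeriv_comp_add_right]
    simp
  simp_rw [key]
  exact (ContinuousLinearMap.continuous _).comp
    (hH.continuous_iteratedFDeriv (by exact_mod_cast le_top))

theorem toTest_coe {g : E3 → Fin 3 → ℂ} (h : ContDiff ℝ ∞ g) (h' : HasCompactSupport g) :
    (toTest g : E3 → Fin 3 → ℂ) = g := by
  rw [toTest, dif_pos ⟨h, h'⟩]; rfl

/-- The common compact set K lets the family factor through the functions supported in K.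
Convergence there means uniform convergence of each derivative, which follows from joint continuity
on K, since all derivatives vanish off K. -/
theorem continuous_toTest {H : ℝ → E3 → Fin 3 → ℂ} (hH : ContDiff ℝ ∞ (Function.uncurry H))
    {K : Set E3} (hK : IsCompact K) (hs : ∀ ρ, Function.support (H ρ) ⊆ K) :
    Continuous (fun ρ => toTest (H ρ)) := by
  have hsm : ∀ ρ, ContDiff ℝ ∞ (H ρ) := fun ρ =>
    hH.comp (contDiff_const.prodMk contDiff_id)
  have hcs : ∀ ρ, HasCompactSupport (H ρ) := fun ρ => HasCompactSupport.of_support_subset_isCompact hK (hs ρ)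
  let Kc : TopologicalSpace.Compacts E3 := ⟨K, hK⟩
  let φ : ℝ → 𝓓_{Kc}(E3, Fin 3 → ℂ) := fun ρ =>
    ContDiffMapSupportedIn.of_support_subset (hsm ρ) (hs ρ)
  have hφ : ∀ ρ, toTest (H ρ) = TestFunction.ofSupportedIn (K := Kc)
      (Set.subset_univ _ : (Kc : Set E3) ⊆ ((⊤ : TopologicalSpace.Opens E3) : Set E3)) (φ ρ) := by
    intro ρ
    ext x : 1
    rw [toTest_coe (hsm ρ) (hcs ρ)]
    rfl
  simp_rw [hφ]
  refine (TestFunction.continuous_ofSupportedIn _).comp ?_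
  rw [ContDiffMapSupportedIn.continuous_iff_comp]
  intro i
  rw [continuous_iff_continuousAt]
  intro ρ₀
  rw [ContinuousAt, BoundedContinuousFunction.tendsto_iff_tendstoUniformly]
  have hc := continuous_iteratedFDeriv_slice hH i
  have hval : ∀ ρ y, (ContDiffMapSupportedIn.structureMapCLM ℝ ⊤ i ∘ φ) ρ y
      = iteratedFDeriv ℝ i (H ρ) y := by
    intro ρ y
    simp only [Function.comp_apply, ContDiffMapSupportedIn.structureMapCLM_top_apply]
    rfl
  have hz : ∀ ρ, ∀ y ∉ K, iteratedFDeriv ℝ i (H ρ) y = 0 := fun ρ y hy =>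
    (φ ρ).iteratedFDeriv_zero_on_compl hy
  rw [Metric.tendstoUniformly_iff]
  intro ε hε
  have hU : TendstoUniformlyOn (fun ρ y => iteratedFDeriv ℝ i (H ρ) y)
      (iteratedFDeriv ℝ i (H ρ₀)) (𝓝 ρ₀) K := by
    have : CompactSpace K := isCompact_iff_compactSpace.mp hK
    rw [tendstoUniformlyOn_iff_tendstoUniformly_comp_coe]
    exact Continuous.tendstoUniformly (fun ρ (y : K) => iteratedFDeriv ℝ i (H ρ) y)
      (hc.comp (continuous_fst.prodMk (continuous_subtype_val.comp continuous_snd))) ρ₀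
  rw [Metric.tendstoUniformlyOn_iff] at hU
  filter_upwards [hU ε hε] with ρ hρ y
  rw [hval, hval]
  by_cases hy : y ∈ K
  · exact hρ y hy
  · rw [hz _ _ hy, hz _ _ hy]; simpa using hε

theorem contDiff_piSingle (j : Fin 3) : ContDiff ℝ ∞ (fun z : ℂ => (Pi.single j z : Fin 3 → ℂ)) := by
  refine contDiff_pi.2 fun i => ?_
  by_cases h : i = j
  · subst h; simp only [Pi.single_eq_same]; exact contDiff_id
  · simpa [Pi.single_apply, h] using contDiff_const

theorem toTest_smul {g : E3 → Fin 3 → ℂ} (h : ContDiff ℝ ∞ g) (h' : HasCompactSupport g) (c : ℂ) :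
    toTest (c • g) = c • toTest g := by
  have h1 : ContDiff ℝ ∞ (c • g) := h.const_smul c
  have h2 : HasCompactSupport (c • g) := h'.smul_left (f := fun _ => c)
  ext x : 1
  rw [toTest_coe h1 h2]
  change _ = c • (toTest g x)
  rw [toTest_coe h h']
  rfl

theorem support_single_subset {χ g : E3 → ℂ} (j : Fin 3) :
    Function.support (fun y => (Pi.single j (χ y * g y) : Fin 3 → ℂ)) ⊆ tsupport χ := by
  intro y hy
  by_contra h
  apply hy
  simp [image_eq_zero_of_notMem_tsupport h]

theorem hasCompactSupport_single {χ g : E3 → ℂ} (hχ : HasCompactSupport χ) (j : Fin 3) :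
    HasCompactSupport (fun y => (Pi.single j (χ y * g y) : Fin 3 → ℂ)) :=
  HasCompactSupport.of_support_subset_isCompact hχ (support_single_subset j)

theorem continuous_pair {χ : E3 → ℂ} (hχ : HasCompactSupport χ) {g : ℝ → E3 → ℂ}
    (hg : ContDiff ℝ ∞ (fun z : ℝ × E3 => χ z.2 * g z.1 z.2)) (u : VecDist) (j : Fin 3) :
    Continuous (fun ρ => pair χ u (g ρ) j) := by
  unfold pair
  refine u.continuous.comp ?_
  refine continuous_toTest (K := tsupport χ) ?_ hχ (fun ρ => support_single_subset j)
  exact (contDiff_piSingle j).comp hg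

theorem pair_smul {χ : E3 → ℂ} (hχ : HasCompactSupport χ) {g : E3 → ℂ}
    (hg : ContDiff ℝ ∞ (fun y => χ y * g y)) (u : VecDist) (j : Fin 3) (c : ℂ) :
    pair χ u (fun y => c * g y) j = c * pair χ u g j := by
  unfold pair
  have hs := toTest_smul ((contDiff_piSingle j).comp hg) (hasCompactSupport_single hχ j) c
  rw [← smul_eq_mul c, ← map_smul]
  refine congrArg u (Eq.trans ?_ hs)
  congr 1
  ext y i
  by_cases h : i = j
  · subst h; simp; ring
  · simp [h]

/-! ### The far-field pattern as the limit ρ → 0 of a smooth kernel. -/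

/-- The kernel `r e^{-iκr} Φ(κ, r x, y)`, written in the variable `ρ = 1 / r`, in which it is smooth
up to `ρ = 0`. -/
def scaledKernel (κ : ℝ) (x : E3) (ρ : ℝ) (y : E3) : ℂ :=
  Complex.exp (Complex.I * κ * ((ρ * ‖y‖ ^ 2 - 2 * inner ℝ x y) / (‖x - ρ • y‖ + 1) : ℝ)) /
    ((4 * Real.pi * ‖x - ρ • y‖ : ℝ) : ℂ)

theorem scaledKernel_inv (κ : ℝ) {x : E3} (hx : ‖x‖ = 1) {r : ℝ} (hr : 0 < r) (y : E3) :
    scaledKernel κ x (1 / r) y = (r * Complex.exp (-(Complex.I * κ * r))) * Phi κ (r • x) y := by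
  have h1 : ‖r • x - y‖ = r * ‖x - (1 / r) • y‖ := by
    rw [← abs_of_pos hr, ← Real.norm_eq_abs, ← norm_smul, Real.norm_eq_abs, abs_of_pos hr, smul_sub,
      smul_smul, mul_one_div_cancel hr.ne', one_smul]
  set a := ‖x - (1 / r) • y‖ with ha
  have ha0 : 0 ≤ a := norm_nonneg _
  have h2 : a ^ 2 = 1 - 2 * (1 / r) * inner ℝ x y + (1 / r) ^ 2 * ‖y‖ ^ 2 := by
    rw [ha, norm_sub_sq_real, hx, norm_smul, inner_smul_right, Real.norm_eq_abs,
      abs_of_pos (one_div_pos.2 hr)]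
    ring
  -- The phase |r x - y| - r = r(a - 1) is rationalised as r(a² - 1)/(a + 1); this removes the
  -- singularity at ρ = 0.
  have h3 : (1 / r * ‖y‖ ^ 2 - 2 * inner ℝ x y) / (a + 1) = r * a - r := by
    rw [div_eq_iff (by positivity)]
    have : (r * a - r) * (a + 1) = r * (a ^ 2 - 1) := by ring
    rw [this, h2]; field_simp; ring
  unfold scaledKernel Phi
  rw [← ha, h1, h3]
  have h4 : Complex.I * κ * ((r * a - r : ℝ) : ℂ) =
      -(Complex.I * κ * r) + Complex.I * κ * ((r * a : ℝ) : ℂ) := by push_cast; ring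
  rw [h4, Complex.exp_add]
  have hr' : (r : ℂ) ≠ 0 := by exact_mod_cast hr.ne'
  -- At the singular point both sides vanish, by the convention for division by zero.
  by_cases h0 : a = 0
  · simp [h0]
  have ha' : (a : ℂ) ≠ 0 := by exact_mod_cast h0
  have hpi : (Real.pi : ℂ) ≠ 0 := by exact_mod_cast Real.pi_ne_zero
  push_cast
  field_simp

theorem scaledKernel_zero (κ : ℝ) {x : E3} (hx : ‖x‖ = 1) (y : E3) :
    scaledKernel κ x 0 y =
      (1 / (4 * Real.pi)) * Complex.exp (-(Complex.I * κ * (inner ℝ x y : ℝ))) := by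
  unfold scaledKernel
  simp only [zero_mul, zero_smul, sub_zero, hx, zero_sub]
  rw [show (-(2 * inner ℝ x y) / (1 + 1) : ℝ) = -inner ℝ x y by ring]
  push_cast
  rw [mul_neg]
  ring

theorem contDiffAt_scaledKernel (κ : ℝ) (x : E3) {ρ : ℝ} {y : E3} (h : x - ρ • y ≠ 0) :
    ContDiffAt ℝ ∞ (fun z : ℝ × E3 => scaledKernel κ x z.1 z.2) (ρ, y) := by
  have h1 : ContDiffAt ℝ ∞ (fun z : ℝ × E3 => ‖x - z.1 • z.2‖) (ρ, y) :=
    ContDiffAt.norm ℝ (contDiff_const.sub (contDiff_fst.smul contDiff_snd)).contDiffAt h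
  have hpos : 0 < ‖x - ρ • y‖ := norm_pos_iff.2 h
  have h2 : ContDiffAt ℝ ∞ (fun z : ℝ × E3 =>
      (z.1 * ‖z.2‖ ^ 2 - 2 * inner ℝ x z.2) / (‖x - z.1 • z.2‖ + 1)) (ρ, y) := by
    refine ContDiffAt.div ?_ (h1.add contDiffAt_const) (by positivity)
    refine ContDiff.contDiffAt ?_
    exact (contDiff_fst.mul ((contDiff_snd (𝕜 := ℝ) (E := ℝ) (F := E3)).norm_sq ℝ)).sub
      (contDiff_const.mul (ContDiff.inner ℝ (contDiff_const (c := x)) contDiff_snd))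
  have hof : ContDiff ℝ ∞ (fun t : ℝ => (t : ℂ)) := Complex.ofRealCLM.contDiff
  simp only [scaledKernel, div_eq_mul_inv (Complex.exp _)]
  refine ContDiffAt.mul ?_ (ContDiffAt.inv ?_ ?_)
  · exact (contDiffAt_const.mul (hof.contDiffAt.comp (ρ, y) h2)).cexp
  · exact hof.contDiffAt.comp (ρ, y) (contDiffAt_const.mul h1)
  · exact_mod_cast (by positivity : (4 * Real.pi * ‖x - ρ • y‖) ≠ 0)

/-- The kernel is smooth only where x ≠ ρy. Substituting ρ = ε sin t keeps |ρy| ≤ 1/2 < |x| on the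
support of χ, and so gives a family that is smooth for all real t, as `continuous_pair` demands. -/
theorem exists_contDiff_cutoff_scaledKernel {χ : E3 → ℂ} (hχ : ContDiff ℝ ∞ χ)
    (hχc : HasCompactSupport χ) (κ : ℝ) {x : E3} (hx : ‖x‖ = 1) :
    ∃ ε > 0, ContDiff ℝ ∞ (fun z : ℝ × E3 =>
      χ z.2 * scaledKernel κ x (ε * Real.sin z.1) z.2) := by
  obtain ⟨R, hR⟩ := hχc.isCompact.isBounded.exists_norm_le
  have hR' : 0 < |R| + 1 := by positivity
  refine ⟨1 / (2 * (|R| + 1)), by positivity, ?_⟩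
  rw [contDiff_iff_contDiffAt]
  rintro ⟨ρ, y⟩
  by_cases hy : y ∈ tsupport χ
  · refine (hχ.contDiffAt.comp (ρ, y) contDiffAt_snd).mul ?_
    have hne : x - (1 / (2 * (|R| + 1)) * Real.sin ρ) • y ≠ 0 := by
      intro h
      have h1 : ‖x‖ = ‖(1 / (2 * (|R| + 1)) * Real.sin ρ) • y‖ := by rw [sub_eq_zero.1 h]
      rw [hx, norm_smul, norm_mul, Real.norm_eq_abs, Real.norm_eq_abs] at h1
      have h2 : |Real.sin ρ| ≤ 1 := Real.abs_sin_le_one ρ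
      have h3 : ‖y‖ ≤ |R| + 1 := (hR y hy).trans (by linarith [le_abs_self R])
      have h4 : |1 / (2 * (|R| + 1))| = 1 / (2 * (|R| + 1)) := abs_of_pos (by positivity)
      rw [h4] at h1
      have h5 : 1 / (2 * (|R| + 1)) * |Real.sin ρ| * ‖y‖ ≤ 1 / (2 * (|R| + 1)) * 1 * (|R| + 1) := by
        gcongr
      have h6 : 1 / (2 * (|R| + 1)) * 1 * (|R| + 1) = 1 / 2 := by field_simp
      linarith
    exact (contDiffAt_scaledKernel κ x hne).comp (ρ, y)
      (ContDiff.contDiffAt ((contDiff_const.mul (Real.contDiff_sin.comp contDiff_fst)).prodMk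
        contDiff_snd))
  · have hev : ∀ᶠ z : ℝ × E3 in 𝓝 (ρ, y), χ z.2 = 0 := by
      have := (isClosed_tsupport χ).isOpen_compl.mem_nhds hy
      filter_upwards [continuous_snd.continuousAt.preimage_mem_nhds this] with z hz
      exact image_eq_zero_of_notMem_tsupport hz
    refine (contDiffAt_const (c := (0 : ℂ))).congr_of_eventuallyEq ?_
    filter_upwards [hev] with z hz
    simp [hz]

theorem tendsto_electricField {χ : E3 → ℂ} (hχ : ContDiff ℝ ∞ χ) (hχc : HasCompactSupport χ)
    (u : VecDist) (κ : ℝ) {x : E3} (hx : ‖x‖ = 1) (j : Fin 3) :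
    Tendsto (fun r : ℝ => r * Complex.exp (-(Complex.I * κ * r)) *
        electricField χ u κ (r • x) j) atTop (𝓝 (farField χ u x κ j)) := by
  obtain ⟨ε, hε, hsm⟩ := exists_contDiff_cutoff_scaledKernel hχ hχc κ hx
  have hslice : ∀ ρ, ContDiff ℝ ∞ (fun y => χ y * scaledKernel κ x (ε * Real.sin ρ) y) := fun ρ =>
    hsm.comp (contDiff_const.prodMk contDiff_id)
  have hcont := continuous_pair hχc (g := fun ρ => scaledKernel κ x (ε * Real.sin ρ)) hsm u j
  -- This is the parameter t with ε sin t = 1/r, available as soon as r ≥ 1/ε.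
  have harc : Tendsto (fun r : ℝ => Real.arcsin (1 / r / ε)) atTop (𝓝 0) := by
    have h1 : Tendsto (fun r : ℝ => 1 / r / ε) atTop (𝓝 (0 / ε)) :=
      (tendsto_const_nhds.div_atTop tendsto_id).div_const ε
    rw [zero_div] at h1
    have := (Real.continuous_arcsin.tendsto 0).comp h1
    rwa [Real.arcsin_zero] at this
  have hlim := ((hcont.tendsto 0).comp harc).const_mul (Complex.I * κ)
  have h0 : Complex.I * κ * pair χ u (scaledKernel κ x (ε * Real.sin 0)) j =
      farField χ u x κ j := by
    have hexp : ContDiff ℝ ∞ (fun y => χ y *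
        Complex.exp (-(Complex.I * κ * (inner ℝ x y : ℝ)))) := by
      refine hχ.mul (ContDiff.cexp (contDiff_const.mul ?_).neg)
      exact Complex.ofRealCLM.contDiff.comp (contDiff_const.inner ℝ contDiff_id)
    have : scaledKernel κ x (ε * Real.sin 0) = fun y =>
        (1 / (4 * Real.pi)) * Complex.exp (-(Complex.I * κ * (inner ℝ x y : ℝ))) := by
      ext y; rw [Real.sin_zero, mul_zero, scaledKernel_zero κ hx]
    rw [this, pair_smul hχc hexp]
    unfold farField
    ring
  rw [h0] at hlim
  refine hlim.congr' ?_
  filter_upwards [eventually_gt_atTop 0, eventually_ge_atTop (1 / ε)] with r hr hr'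
  have hs : ε * Real.sin (Real.arcsin (1 / r / ε)) = 1 / r := by
    rw [Real.sin_arcsin]
    · field_simp
    · exact le_trans (by norm_num) (by positivity : 0 ≤ 1 / r / ε)
    · rw [div_div, div_le_one (by positivity)]
      rwa [div_le_iff₀ hε] at hr'
  set c : ℂ := r * Complex.exp (-(Complex.I * κ * r)) with hc
  have hc0 : c ≠ 0 := mul_ne_zero (by exact_mod_cast hr.ne') (Complex.exp_ne_zero _)
  have hk : (fun y => Phi κ (r • x) y) = fun y => c⁻¹ * scaledKernel κ x (1 / r) y := by
    ext y
    rw [scaledKernel_inv κ hx hr, ← hc, inv_mul_cancel_left₀ hc0]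
  have hsl := hslice (Real.arcsin (1 / r / ε))
  simp only [Function.comp_apply]
  rw [hs] at hsl ⊢
  unfold electricField
  rw [hk, pair_smul hχc hsl]
  field_simp

/-! ### Fourth moments of Gaussian variables and the Wick formula. -/

theorem iteratedDeriv_four_exp_sq (v : ℝ) :
    iteratedDeriv 4 (fun t : ℝ => Real.exp (v * t ^ 2 / 2)) 0 = 3 * v ^ 2 := by
  have h0 : ∀ t : ℝ, HasDerivAt (fun t : ℝ => Real.exp (v * t ^ 2 / 2))
      (Real.exp (v * t ^ 2 / 2) * (v * t)) t := fun t => by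
    have h : HasDerivAt (fun t : ℝ => v * t ^ 2 / 2) (v * t) t := by
      refine (((hasDerivAt_pow 2 t).const_mul v).div_const 2).congr_deriv ?_
      push_cast; ring
    exact h.exp
  -- Differentiation maps e^{vt²/2} p to e^{vt²/2} (vtp + p'); the polynomial factor is followed
  -- through four derivatives, starting from p = 1.
  have step : ∀ (p q : ℝ → ℝ) (_ : ∀ t, HasDerivAt p (q t) t),
      deriv (fun t => Real.exp (v * t ^ 2 / 2) * p t) =
        fun t => Real.exp (v * t ^ 2 / 2) * (v * t * p t + q t) := fun p q h => by
    ext t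
    refine (((h0 t).mul (h t)).congr_deriv ?_).deriv
    ring
  have e0 : (fun t : ℝ => Real.exp (v * t ^ 2 / 2)) =
      fun t => Real.exp (v * t ^ 2 / 2) * (1 : ℝ) := by simp
  rw [iteratedDeriv_eq_iterate]
  simp only [Function.iterate_succ, Function.iterate_zero, Function.comp_apply, id]
  rw [e0, step (fun _ => 1) (fun _ => 0) (fun t => hasDerivAt_const t _),
    step (fun t => v * t * 1 + 0) (fun _ => v) (fun t => by
      simpa using (hasDerivAt_id t).const_mul v),
    step (fun t => v * t * (v * t * 1 + 0) + v) (fun t => 2 * v ^ 2 * t) (fun t => by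
      refine ((((hasDerivAt_pow 2 t).const_mul (v ^ 2)).add_const v).congr_deriv ?_
        ).congr_of_eventuallyEq (Eventually.of_forall fun t => ?_)
      · push_cast; ring
      · ring),
    step (fun t => v * t * (v * t * (v * t * 1 + 0) + v) + 2 * v ^ 2 * t)
      (fun t => 3 * v ^ 3 * t ^ 2 + 3 * v ^ 2) (fun t => by
      refine ((((hasDerivAt_pow 3 t).const_mul (v ^ 3)).add
        ((hasDerivAt_id t).const_mul (3 * v ^ 2))).congr_deriv ?_
        ).congr_of_eventuallyEq (Eventually.of_forall fun t => ?_)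
      · push_cast; ring
      · simp only [Pi.add_apply, id]; ring)]
  simp

section Gaussian

variable {Ω : Type*} [MeasurableSpace Ω] {P : Measure Ω}

/-- The fourth moment is the fourth derivative at 0 of the moment generating function e^{vt²/2}. It
is the only input on Gaussian laws from which the Wick formula is polarised. -/
theorem integral_pow_four_of_hasGaussianLaw {X : Ω → ℝ} (hX : HasGaussianLaw X P)
    (h0 : ∫ s, X s ∂P = 0) : ∫ s, X s ^ 4 ∂P = 3 * (∫ s, X s ^ 2 ∂P) ^ 2 := by
  have := hX.isProbabilityMeasure
  have hmap := hX.map_eq_gaussianReal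
  have hmgf := mgf_gaussianReal hmap
  have hint : integrableExpSet X P = univ := by
    have : integrableExpSet id (P.map X) = univ := by
      rw [hmap]; exact integrableExpSet_id_gaussianReal
    rw [eq_univ_iff_forall] at this ⊢
    intro t
    have := (integrable_map_measure (by fun_prop) hX.aemeasurable).1 (this t)
    exact this
  have hv : ((Var[X; P]).toNNReal : ℝ) = ∫ s, X s ^ 2 ∂P := by
    rw [Real.coe_toNNReal _ (variance_nonneg _ _), variance_of_integral_eq_zero hX.aemeasurable h0]
  have h4 := iteratedDeriv_mgf_zero (X := X) (μ := P) (by rw [hint]; simp) 4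
  have hfun : mgf X P = fun t => Real.exp ((∫ s, X s ^ 2 ∂P) * t ^ 2 / 2) := by
    ext t
    rw [hmgf, hv, h0]; simp
  rw [hfun, iteratedDeriv_four_exp_sq] at h4
  simpa using h4.symm

variable {R : Submodule ℝ (Ω → ℝ)}

theorem integrable_mul_four {𝕜 : Type*} [RCLike 𝕜] {X₁ X₂ X₃ X₄ : Ω → 𝕜} (h₁ : MemLp X₁ 4 P) (h₂ : MemLp X₂ 4 P)
    (h₃ : MemLp X₃ 4 P) (h₄ : MemLp X₄ 4 P) :
    Integrable (fun s => X₁ s * X₂ s * X₃ s * X₄ s) P := by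
  have : ENNReal.HolderTriple 4 4 2 := ⟨by
    rw [← two_mul, show (4 : ENNReal) = 2 * 2 by norm_num, ENNReal.mul_inv (by simp) (by simp),
      ← mul_assoc, ENNReal.mul_inv_cancel (by simp) (by simp), one_mul]⟩
  have h12 : MemLp (fun s => X₁ s * X₂ s) 2 P := h₂.mul' h₁
  have h34 : MemLp (fun s => X₃ s * X₄ s) 2 P := h₄.mul' h₃
  refine (h12.integrable_mul h34).congr (ae_of_all _ fun s => ?_)
  simp only [Pi.mul_apply]; ring

theorem integral_sum_sq {X : Fin 4 → Ω → ℝ} (h : ∀ i j, Integrable (fun s => X i s * X j s) P)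
    (a : Fin 4 → ℝ) : ∫ s, (∑ i, a i * X i s) ^ 2 ∂P =
      ∑ i, ∑ j, a i * a j * ∫ s, X i s * X j s ∂P := by
  have : ∀ s, (∑ i, a i * X i s) ^ 2 = ∑ i, ∑ j, a i * a j * (X i s * X j s) := fun s => by
    rw [sq, Finset.sum_mul_sum]
    exact Finset.sum_congr rfl fun i _ => Finset.sum_congr rfl fun j _ => by ring
  simp_rw [this]
  rw [integral_finsetSum _ fun i _ => integrable_finsetSum _ fun j _ => (h i j).const_mul _]
  refine Finset.sum_congr rfl fun i _ => ?_
  rw [integral_finsetSum _ fun j _ => (h i j).const_mul _]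
  exact Finset.sum_congr rfl fun j _ => integral_const_mul _ _

/-- The Wick (Isserlis) formula for four centered jointly Gaussian real variables. -/
theorem wick_real (hR : ∀ X ∈ R, HasGaussianLaw X P ∧ ∫ s, X s ∂P = 0) {X : Fin 4 → Ω → ℝ}
    (hX : ∀ i, X i ∈ R) :
    ∫ s, X 0 s * X 1 s * X 2 s * X 3 s ∂P =
      (∫ s, X 0 s * X 1 s ∂P) * (∫ s, X 2 s * X 3 s ∂P) +
      (∫ s, X 0 s * X 2 s ∂P) * (∫ s, X 1 s * X 3 s ∂P) +
      (∫ s, X 0 s * X 3 s ∂P) * (∫ s, X 1 s * X 2 s ∂P) := by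
  have hint : ∀ i j, Integrable (fun s => X i s * X j s) P := fun i j =>
    ((hR _ (hX i)).1.memLp_two).integrable_mul (hR _ (hX j)).1.memLp_two
  have hmem : ∀ a : Fin 4 → ℝ, (fun s => ∑ i, a i * X i s) ∈ R := fun a => by
    have : (fun s => ∑ i, a i * X i s) = ∑ i, a i • X i := by ext s; simp
    rw [this]
    exact R.sum_mem fun i _ => R.smul_mem _ (hX i)
  have h4 : ∀ a : Fin 4 → ℝ, ∫ s, (∑ i, a i * X i s) ^ 4 ∂P =
      3 * (∑ i, ∑ j, a i * a j * ∫ s, X i s * X j s ∂P) ^ 2 := fun a => by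
    rw [integral_pow_four_of_hasGaussianLaw (hR _ (hmem a)).1 (hR _ (hmem a)).2,
      integral_sum_sq hint]
  have hi4 : ∀ a : Fin 4 → ℝ, Integrable (fun s => (∑ i, a i * X i s) ^ 4) P := fun a => by
    have h := (hR _ (hmem a)).1.memLp (p := 4) (by simp)
    refine (integrable_mul_four h h h h).congr (ae_of_all _ fun s => ?_)
    ring
  let e : Fin 2 → ℝ := ![1, -1]
  -- Polarisation: averaging over the signs of X₁, X₂, X₃ kills every monomial of the fourth power
  -- that is not odd in each of them. Only 24 X₀X₁X₂X₃ survives, once for each of the 8 sign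
  -- patterns, whence 192.
  have hpol : ∀ s, 192 * (X 0 s * X 1 s * X 2 s * X 3 s) = ∑ p, ∑ q, ∑ r,
      e p * e q * e r * (∑ i, (![1, e p, e q, e r] : Fin 4 → ℝ) i * X i s) ^ 4 := fun s => by
    simp [Fin.sum_univ_two, Fin.sum_univ_four, e]
    ring
  have hsymm : ∀ i j, ∫ s, X i s * X j s ∂P = ∫ s, X j s * X i s ∂P := fun i j => by
    simp_rw [mul_comm]
  have hfin : 192 * ∫ s, X 0 s * X 1 s * X 2 s * X 3 s ∂P = ∑ p, ∑ q, ∑ r,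
      e p * e q * e r * (3 * (∑ i, ∑ j, (![1, e p, e q, e r] : Fin 4 → ℝ) i *
        (![1, e p, e q, e r] : Fin 4 → ℝ) j * ∫ s, X i s * X j s ∂P) ^ 2) := by
    rw [← integral_const_mul]
    simp_rw [hpol, ← h4]
    rw [integral_finsetSum _ fun p _ => integrable_finsetSum _ fun q _ =>
      integrable_finsetSum _ fun r _ => (hi4 _).const_mul _]
    refine Finset.sum_congr rfl fun p _ => ?_
    rw [integral_finsetSum _ fun q _ => integrable_finsetSum _ fun r _ => (hi4 _).const_mul _]
    refine Finset.sum_congr rfl fun q _ => ?_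
    rw [integral_finsetSum _ fun r _ => (hi4 _).const_mul _]
    exact Finset.sum_congr rfl fun r _ => integral_const_mul _ _
  simp only [Fin.sum_univ_two, Fin.sum_univ_four, e, Matrix.cons_val_zero, Matrix.cons_val_one,
    Matrix.cons_val] at hfin
  rw [hsymm 1 0, hsymm 2 0, hsymm 3 0, hsymm 2 1, hsymm 3 1, hsymm 3 2] at hfin
  linarith

/-- The defect in the Wick formula. -/
def wickDefect (P : Measure Ω) (Z : Fin 4 → Ω → ℂ) : ℂ :=
  ∫ s, Z 0 s * Z 1 s * Z 2 s * Z 3 s ∂P - (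
    (∫ s, Z 0 s * Z 1 s ∂P) * (∫ s, Z 2 s * Z 3 s ∂P) +
    (∫ s, Z 0 s * Z 2 s ∂P) * (∫ s, Z 1 s * Z 3 s ∂P) +
    (∫ s, Z 0 s * Z 3 s ∂P) * (∫ s, Z 1 s * Z 2 s ∂P))

theorem integral_mul_complex {X Y W : Ω → ℂ} (hX : MemLp X 4 P) (hY : MemLp Y 4 P)
    (hW : MemLp W 4 P) [IsProbabilityMeasure P] :
    ∫ s, (X s + Complex.I * Y s) * W s ∂P = ∫ s, X s * W s ∂P + Complex.I * ∫ s, Y s * W s ∂P := by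
  have h : ∀ {A : Ω → ℂ}, MemLp A 4 P → MemLp A 2 P := fun hA =>
    hA.mono_exponent (by norm_num)
  have h1 : Integrable (fun s => X s * W s) P := (h hX).integrable_mul (h hW)
  have h2 : Integrable (fun s => Y s * W s) P := (h hY).integrable_mul (h hW)
  rw [← integral_const_mul, ← integral_add h1 (h2.const_mul _)]
  exact integral_congr_ae (ae_of_all _ fun s => by ring)

/-- Every term of the defect is ℂ-linear in each of the four variables. This reduces the complex
Wick formula to the real one. -/
theorem wickDefect_update [IsProbabilityMeasure P] {Z : Fin 4 → Ω → ℂ} (hZ : ∀ i, MemLp (Z i) 4 P)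
    {X Y : Ω → ℂ} (hX : MemLp X 4 P) (hY : MemLp Y 4 P) (i : Fin 4) :
    wickDefect P (Function.update Z i (fun s => X s + Complex.I * Y s)) =
      wickDefect P (Function.update Z i X) + Complex.I * wickDefect P (Function.update Z i Y) := by
  have key : ∀ A B C : Ω → ℂ, MemLp A 4 P → MemLp B 4 P → MemLp C 4 P →
      ∫ s, (X s + Complex.I * Y s) * A s * B s * C s ∂P =
        ∫ s, X s * A s * B s * C s ∂P + Complex.I * ∫ s, Y s * A s * B s * C s ∂P := by
    intro A B C hA hB hC
    rw [← integral_const_mul, ← integral_add (integrable_mul_four hX hA hB hC)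
      ((integrable_mul_four hY hA hB hC).const_mul _)]
    exact integral_congr_ae (ae_of_all _ fun s => by ring)
  -- The commutations below move the updated variable to the front, where `key` and `key2` apply.
  have comm2 : ∀ A B : Ω → ℂ, ∫ s, A s * B s ∂P = ∫ s, B s * A s ∂P := fun A B => by
    simp_rw [mul_comm]
  have key2 := fun j => integral_mul_complex hX hY (hZ j)
  have c1 : ∀ A B C D : Ω → ℂ, ∫ s, A s * B s * C s * D s ∂P = ∫ s, B s * A s * C s * D s ∂P :=
    fun A B C D => integral_congr_ae (ae_of_all _ fun s => by ring)
  have c2 : ∀ A B C D : Ω → ℂ, ∫ s, A s * B s * C s * D s ∂P = ∫ s, C s * A s * B s * D s ∂P :=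
    fun A B C D => integral_congr_ae (ae_of_all _ fun s => by ring)
  have c3 : ∀ A B C D : Ω → ℂ, ∫ s, A s * B s * C s * D s ∂P = ∫ s, D s * A s * B s * C s ∂P :=
    fun A B C D => integral_congr_ae (ae_of_all _ fun s => by ring)
  unfold wickDefect
  fin_cases i
  · simp [Function.update, key _ _ _ (hZ 1) (hZ 2) (hZ 3), key2]
    ring
  · simp only [Function.update]
    simp [c1 (Z 0), comm2 (Z 0) X, comm2 (Z 0) Y, comm2 (Z 0) (fun s => X s + Complex.I * Y s),
      key _ _ _ (hZ 0) (hZ 2) (hZ 3), key2]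
    ring
  · simp only [Function.update]
    simp [c2 (Z 0), comm2 (Z 0) X, comm2 (Z 0) Y, comm2 (Z 0) (fun s => X s + Complex.I * Y s),
      comm2 (Z 1) X, comm2 (Z 1) Y, comm2 (Z 1) (fun s => X s + Complex.I * Y s),
      key _ _ _ (hZ 0) (hZ 1) (hZ 3), key2]
    ring
  · simp only [Function.update]
    simp [c3 (Z 0), comm2 (Z 0) X, comm2 (Z 0) Y, comm2 (Z 0) (fun s => X s + Complex.I * Y s),
      comm2 (Z 1) X, comm2 (Z 1) Y, comm2 (Z 1) (fun s => X s + Complex.I * Y s),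
      comm2 (Z 2) X, comm2 (Z 2) Y, comm2 (Z 2) (fun s => X s + Complex.I * Y s),
      key _ _ _ (hZ 0) (hZ 1) (hZ 2), key2]
    ring

theorem memLp_of_re_im
    (hR : ∀ X ∈ R, HasGaussianLaw X P ∧ ∫ s, X s ∂P = 0) {W : Ω → ℂ}
    (hW : (fun s => (W s).re) ∈ R ∧ (fun s => (W s).im) ∈ R) : MemLp W 4 P := by
  have hL : ∀ X ∈ R, MemLp (fun s => (X s : ℂ)) 4 P := fun X hX =>
    ((hR X hX).1.memLp (p := 4) (by simp)).ofReal
  have h := (hL _ hW.1).add ((hL _ hW.2).const_mul Complex.I)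
  refine h.ae_eq (ae_of_all _ fun s => ?_)
  simp only [Pi.add_apply]
  rw [mul_comm]; exact Complex.re_add_im _

/-- The Wick (Isserlis) formula for complex variables whose real and imaginary parts lie in a space
of centered Gaussian variables. -/
theorem wick_complex [IsProbabilityMeasure P]
    (hR : ∀ X ∈ R, HasGaussianLaw X P ∧ ∫ s, X s ∂P = 0) {Z : Fin 4 → Ω → ℂ}
    (hZ : ∀ i, (fun s => (Z i s).re) ∈ R ∧ (fun s => (Z i s).im) ∈ R) :
    wickDefect P Z = 0 := by
  have hL : ∀ X ∈ R, MemLp (fun s => (X s : ℂ)) 4 P := fun X hX =>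
    ((hR X hX).1.memLp (p := 4) (by simp)).ofReal
  have hreal : ∀ X ∈ R, (fun s => ((X s : ℂ)).re) ∈ R ∧ (fun s => ((X s : ℂ)).im) ∈ R := by
    intro X hX
    simp only [Complex.ofReal_re, Complex.ofReal_im]
    exact ⟨hX, R.zero_mem⟩
  -- Induction on the number k of slots still allowed to be complex: the slots from k on are real,
  -- and the inductive step splits slot k into its real and imaginary parts.
  have main : ∀ k : ℕ, ∀ Z : Fin 4 → Ω → ℂ,
      (∀ i, (fun s => (Z i s).re) ∈ R ∧ (fun s => (Z i s).im) ∈ R) →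
      (∀ i : Fin 4, k ≤ i → ∃ X ∈ R, Z i = fun s => (X s : ℂ)) → wickDefect P Z = 0 := by
    intro k
    induction k with
    | zero =>
      intro Z _ h
      choose X hX hXZ using fun i => h i (Nat.zero_le _)
      have h1 := wick_real hR hX
      simp only [wickDefect, hXZ, ← Complex.ofReal_mul, integral_complex_ofReal]
      rw [h1]; push_cast; ring
    | succ k ih =>
      intro Z hZ h
      by_cases hk : k < 4
      · set i : Fin 4 := ⟨k, hk⟩ with hi
        have hup : Z = Function.update Z i
            (fun s => ((Z i s).re : ℂ) + Complex.I * ((Z i s).im : ℂ)) := by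
          conv_lhs => rw [← Function.update_eq_self i Z]
          congr 1
          ext s
          rw [mul_comm]; exact (Complex.re_add_im _).symm
        have hstep : ∀ X ∈ R, wickDefect P (Function.update Z i (fun s => (X s : ℂ))) = 0 := by
          intro X hX
          refine ih _ (fun l => ?_) (fun l hl => ?_)
          · by_cases hli : l = i
            · rw [hli, Function.update_self]; exact hreal X hX
            · rw [Function.update_of_ne hli]; exact hZ l
          · by_cases hli : l = i
            · rw [hli, Function.update_self]; exact ⟨X, hX, rfl⟩
            · rw [Function.update_of_ne hli]
              refine h l ?_
              have : (l : ℕ) ≠ k := fun h' => hli (Fin.ext h')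
              omega
        rw [hup, wickDefect_update (fun l => memLp_of_re_im hR (hZ l)) (hL _ (hZ i).1) (hL _ (hZ i).2),
          hstep _ (hZ i).1, hstep _ (hZ i).2]
        simp
      · exact ih Z hZ (fun i hi => absurd i.2 (by omega))
  exact main 4 Z hZ (fun i hi => absurd i.2 (by omega))

end Gaussian

/-! ### The real Gaussian space spanned by the field. -/

section RealParts

variable {Ω : Type*} {f : Ω → VecDist}

/-- The space of the real parts of the values of a random distribution on test functions. -/
def realParts (f : Ω → VecDist) : Submodule ℝ (Ω → ℝ) where
  carrier := {X | ∃ φ, X = fun s => (f s φ).re}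
  add_mem' := by
    rintro _ _ ⟨φ, rfl⟩ ⟨ψ, rfl⟩
    exact ⟨φ + ψ, by ext s; simp⟩
  zero_mem' := ⟨0, by ext s; simp⟩
  smul_mem' := by
    rintro c _ ⟨φ, rfl⟩
    exact ⟨(c : ℂ) • φ, by ext s; simp⟩

/-- Because f is ℂ-linear, Im z = Re(-iz) turns imaginary parts into real parts at another test
function. The real parts alone thus form a linear space containing everything the Wick formula
needs. -/
theorem re_im_mem_realParts (φ : VecTest) :
    (fun s => (f s φ).re) ∈ realParts f ∧ (fun s => (f s φ).im) ∈ realParts f := by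
  refine ⟨⟨φ, rfl⟩, ⟨(-Complex.I) • φ, ?_⟩⟩
  ext s; simp

theorem re_im_conj_mem_realParts (φ : VecTest) :
    (fun s => (conj (f s φ)).re) ∈ realParts f ∧ (fun s => (conj (f s φ)).im) ∈ realParts f := by
  refine ⟨⟨φ, by ext s; simp⟩, ⟨Complex.I • φ, ?_⟩⟩
  ext s; simp

variable [MeasurableSpace Ω] {P : Measure Ω} {D : Set E3} {m : ℝ} {Ac Ar : MatField}

theorem IsCenteredGMIG.realParts_gaussian [IsProbabilityMeasure P] (hf : IsCenteredGMIG P D m f Ac Ar) :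
    ∀ X ∈ realParts f, HasGaussianLaw X P ∧ ∫ s, X s ∂P = 0 := by
  rintro _ ⟨φ, rfl⟩
  refine ⟨(hf.gaussian φ).map_fun Complex.reCLM, ?_⟩
  have := (Complex.reCLM.integral_comp_comm (hf.gaussian φ).integrable)
  rw [hf.centered φ] at this
  simpa using this

end RealParts

/-! ### A strong law of large numbers for continuous-parameter processes. -/

section Averages

variable {Ω : Type*} [MeasurableSpace Ω] {P : Measure Ω}

/-- By monotone convergence the sum of the Z n has finite expectation, so it converges almost surely
and its terms tend to zero. -/
theorem ae_tendsto_zero_of_summable_integral {Z : ℕ → Ω → ℝ} {c : ℕ → ℝ}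
    (hZ : ∀ n, Integrable (Z n) P) (hpos : ∀ n s, 0 ≤ Z n s) (hle : ∀ n, ∫ s, Z n s ∂P ≤ c n)
    (hc : Summable c) : ∀ᵐ s ∂P, Tendsto (fun n => Z n s) atTop (𝓝 0) := by
  have h1 : ∫⁻ s, ∑' n, ENNReal.ofReal (Z n s) ∂P ≠ ⊤ := by
    rw [lintegral_tsum fun n => (hZ n).aemeasurable.ennreal_ofReal]
    have h2 : ∀ n, ∫⁻ s, ENNReal.ofReal (Z n s) ∂P ≤ ENNReal.ofReal (c n) := fun n => by
      rw [← ofReal_integral_eq_lintegral_ofReal (hZ n) (ae_of_all _ (hpos n))]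
      exact ENNReal.ofReal_le_ofReal (hle n)
    exact ne_top_of_le_ne_top hc.tsum_ofReal_ne_top (ENNReal.tsum_le_tsum h2)
  have h3 := ae_lt_top' (AEMeasurable.tsum fun n => (hZ n).aemeasurable.ennreal_ofReal) h1
  filter_upwards [h3] with s hs
  have h4 := ENNReal.tendsto_atTop_zero_of_tsum_ne_top hs.ne
  have h5 := (ENNReal.tendsto_toReal ENNReal.zero_ne_top).comp h4
  refine h5.congr fun n => ?_
  simp [ENNReal.toReal_ofReal (hpos n s)]

/-- Fubini: E|∫X|² is the double integral of the correlations E[X_κ conj X_κ']. The uniform second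
moment bound C, through |zw| ≤ (|z|² + |w|²)/2, justifies the exchange. -/
theorem integrable_norm_sq_integral [IsProbabilityMeasure P] {μ : Measure ℝ} [IsFiniteMeasure μ]
    {X : ℝ → Ω → ℂ} (hX : Measurable (Function.uncurry X)) {C : ℝ}
    (hL2 : ∀ᵐ κ ∂μ, MemLp (X κ) 2 P) (hC : ∀ᵐ κ ∂μ, ∫ s, ‖X κ s‖ ^ 2 ∂P ≤ C)
    {K : ℝ → ℝ → ℝ} (hK : ∀ᵐ κ ∂μ, ∀ᵐ κ' ∂μ, ‖∫ s, X κ s * conj (X κ' s) ∂P‖ ≤ K κ κ')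
    (hKm : Measurable (Function.uncurry K)) (hKi : Integrable (Function.uncurry K) (μ.prod μ)) :
    Integrable (fun s => ‖∫ κ, X κ s ∂μ‖ ^ 2) P ∧
      ∫ s, ‖∫ κ, X κ s ∂μ‖ ^ 2 ∂P ≤ ∫ κ, ∫ κ', K κ κ' ∂μ ∂μ := by
  let G : Ω × (ℝ × ℝ) → ℂ := fun z => X z.2.1 z.1 * conj (X z.2.2 z.1)
  have hG : Measurable G := by
    have h1 : Measurable fun z : Ω × (ℝ × ℝ) => X z.2.1 z.1 :=
      hX.comp (measurable_snd.fst.prodMk measurable_fst)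
    have h2 : Measurable fun z : Ω × (ℝ × ℝ) => X z.2.2 z.1 :=
      hX.comp (measurable_snd.snd.prodMk measurable_fst)
    exact h1.mul (Complex.continuous_conj.measurable.comp h2)
  have hfst : ∀ᵐ z ∂(μ.prod μ), MemLp (X z.1) 2 P ∧ ∫ s, ‖X z.1 s‖ ^ 2 ∂P ≤ C :=
    Measure.quasiMeasurePreserving_fst.ae (hL2.and hC)
  have hsnd : ∀ᵐ z ∂(μ.prod μ), MemLp (X z.2) 2 P ∧ ∫ s, ‖X z.2 s‖ ^ 2 ∂P ≤ C :=
    Measure.quasiMeasurePreserving_snd.ae (hL2.and hC)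
  have hGi : Integrable G (P.prod (μ.prod μ)) := by
    rw [integrable_prod_iff' hG.aestronglyMeasurable]
    constructor
    · filter_upwards [hfst, hsnd] with z h1 h2
      exact h1.1.integrable_mul h2.1.star
    · refine (integrable_const C).mono' ?_ ?_
      · exact (hG.norm.stronglyMeasurable.integral_prod_left').aestronglyMeasurable
      · filter_upwards [hfst, hsnd] with z h1 h2
        rw [Real.norm_eq_abs, abs_of_nonneg (integral_nonneg fun s => norm_nonneg _)]
        have i1 := h1.1.integrable_norm_pow (by norm_num)
        have i2 := h2.1.integrable_norm_pow (by norm_num)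
        calc ∫ s, ‖G (s, z)‖ ∂P ≤ ∫ s, (‖X z.1 s‖ ^ 2 + ‖X z.2 s‖ ^ 2) / 2 ∂P := by
              refine integral_mono_of_nonneg (ae_of_all _ fun s => norm_nonneg _)
                ((i1.add i2).div_const 2) (ae_of_all _ fun s => ?_)
              simp only [G, norm_mul, RCLike.norm_conj]
              nlinarith [sq_nonneg (‖X z.1 s‖ - ‖X z.2 s‖)]
          _ ≤ C := by
              rw [integral_div, integral_add i1 i2]
              linarith [h1.2, h2.2]
  have hGs : ∀ s, ∫ z, G (s, z) ∂(μ.prod μ) = ((‖∫ κ, X κ s ∂μ‖ ^ 2 : ℝ) : ℂ) := fun s => by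
    simp only [G]
    rw [integral_prod_mul (fun κ => X κ s) (fun κ => conj (X κ s)), integral_conj, Complex.mul_conj,
      Complex.normSq_eq_norm_sq]
  have hint : Integrable (fun s => ‖∫ κ, X κ s ∂μ‖ ^ 2) P := by
    have := hGi.integral_prod_left
    simp_rw [hGs] at this
    exact this.re.congr (ae_of_all _ fun s => Complex.ofReal_re _)
  refine ⟨hint, ?_⟩
  have h1 : ((∫ s, ‖∫ κ, X κ s ∂μ‖ ^ 2 ∂P : ℝ) : ℂ) = ∫ z, ∫ s, G (s, z) ∂P ∂(μ.prod μ) := by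
    rw [← integral_complex_ofReal]
    simp_rw [← hGs]
    rw [integral_integral_swap hGi]
  have hK' : ∀ᵐ z ∂(μ.prod μ), ‖∫ s, G (s, z) ∂P‖ ≤ K z.1 z.2 := by
    have hns : MeasurableSet {z : ℝ × ℝ | ‖∫ s, G (s, z) ∂P‖ ≤ K z.1 z.2} :=
      measurableSet_le hG.stronglyMeasurable.integral_prod_left'.norm.measurable hKm
    rw [Measure.ae_prod_iff_ae_ae hns]
    exact hK
  have h2 : ‖((∫ s, ‖∫ κ, X κ s ∂μ‖ ^ 2 ∂P : ℝ) : ℂ)‖ ≤ ∫ z, K z.1 z.2 ∂(μ.prod μ) := by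
    rw [h1]
    exact norm_integral_le_of_norm_le hKi hK'
  rw [Complex.norm_real, Real.norm_eq_abs] at h2
  have h3 := (le_abs_self _).trans h2
  refine h3.trans_eq ?_
  exact integral_prod _ hKi

end Averages

section Averages

variable {Ω : Type*} [MeasurableSpace Ω] {P : Measure Ω}

/-- Since ∫(1 + t²)⁻¹ dt = π, decorrelation makes the second moment grow only linearly in the length
of the interval. -/
theorem integral_norm_sq_intervalIntegral_le [IsProbabilityMeasure P]
    {X : ℝ → Ω → ℂ} (hX : Measurable (Function.uncurry X)) {C : ℝ}
    (hL2 : ∀ κ ≥ 1, MemLp (X κ) 2 P)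
    (hC : ∀ κ ≥ 1, ∀ κ' ≥ 1, ‖∫ s, X κ s * conj (X κ' s) ∂P‖ ≤ C * (1 + (κ - κ') ^ 2)⁻¹)
    {a b : ℝ} (ha : 1 ≤ a) (hab : a ≤ b) :
    Integrable (fun s => ‖∫ κ in a..b, X κ s‖ ^ 2) P ∧
      ∫ s, ‖∫ κ in a..b, X κ s‖ ^ 2 ∂P ≤ C * Real.pi * (b - a) := by
  have hsq : ∀ κ ≥ 1, ∫ s, ‖X κ s‖ ^ 2 ∂P ≤ C := fun κ hκ => by
    have h := hC κ hκ κ hκ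
    have h2 : ∫ s, X κ s * conj (X κ s) ∂P = ((∫ s, ‖X κ s‖ ^ 2 ∂P : ℝ) : ℂ) := by
      rw [← integral_complex_ofReal]
      simp_rw [Complex.mul_conj, Complex.normSq_eq_norm_sq]
    rw [h2, Complex.norm_real, Real.norm_eq_abs] at h
    simpa using (le_abs_self _).trans h
  have hC0 : 0 ≤ C := (integral_nonneg fun s => sq_nonneg _).trans (hsq 1 le_rfl)
  simp_rw [intervalIntegral.integral_of_le hab]
  set μ : Measure ℝ := volume.restrict (Ioc a b) with hμ
  have hmem : ∀ᵐ κ ∂μ, 1 ≤ κ := by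
    filter_upwards [ae_restrict_mem measurableSet_Ioc] with κ hκ using ha.trans hκ.1.le
  have hKm : Measurable (Function.uncurry fun κ κ' : ℝ => C * (1 + (κ - κ') ^ 2)⁻¹) := by
    unfold Function.uncurry; fun_prop
  have hKi : Integrable (Function.uncurry fun κ κ' : ℝ => C * (1 + (κ - κ') ^ 2)⁻¹)
      (μ.prod μ) := by
    refine (integrable_const C).mono' hKm.aestronglyMeasurable (ae_of_all _ fun z => ?_)
    simp only [Function.uncurry]
    rw [Real.norm_eq_abs, abs_of_nonneg (by positivity)]
    exact mul_le_of_le_one_right hC0 (inv_le_one_of_one_le₀ (by nlinarith [sq_nonneg (z.1 - z.2)]))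
  obtain ⟨h1, h2⟩ := integrable_norm_sq_integral (μ := μ) hX (hmem.mono hL2) (hmem.mono hsq)
    (K := fun κ κ' : ℝ => C * (1 + (κ - κ') ^ 2)⁻¹)
    (hmem.mono fun κ hκ => hmem.mono fun κ' hκ' => hC κ hκ κ' hκ') hKm hKi
  refine ⟨h1, h2.trans ?_⟩
  have hin : ∀ κ : ℝ, ∫ κ', C * (1 + (κ - κ') ^ 2)⁻¹ ∂μ ≤ C * Real.pi := fun κ => by
    rw [integral_const_mul]
    refine mul_le_mul_of_nonneg_left ?_ hC0
    have hi : Integrable (fun κ' : ℝ => (1 + (κ - κ') ^ 2)⁻¹) :=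
      integrable_inv_one_add_sq.comp_sub_left κ
    calc ∫ κ', (1 + (κ - κ') ^ 2)⁻¹ ∂μ ≤ ∫ κ', (1 + (κ - κ') ^ 2)⁻¹ :=
          setIntegral_le_integral hi (ae_of_all _ fun κ' => by positivity)
      _ = ∫ t : ℝ, (1 + t ^ 2)⁻¹ := integral_sub_left_eq_self (fun t : ℝ => (1 + t ^ 2)⁻¹) volume κ
      _ = Real.pi := integral_univ_inv_one_add_sq
  calc ∫ κ, ∫ κ', C * (1 + (κ - κ') ^ 2)⁻¹ ∂μ ∂μ ≤ ∫ _, C * Real.pi ∂μ :=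
        integral_mono hKi.integral_prod_left (integrable_const _) hin
    _ = C * Real.pi * (b - a) := by
        rw [integral_const, hμ, measureReal_restrict_apply_univ, Real.volume_real_Ioc_of_le hab,
          smul_eq_mul, mul_comm]

/-- Without cancellation the growth is quadratic. This suffices on the short gaps between
consecutive sampling points, where the absolute value must stand inside the integral. -/
theorem integral_sq_intervalIntegral_norm_le [IsProbabilityMeasure P]
    {X : ℝ → Ω → ℂ} (hX : Measurable (Function.uncurry X)) {C : ℝ}
    (hL2 : ∀ κ ≥ 1, MemLp (X κ) 2 P) (hC : ∀ κ ≥ 1, ∫ s, ‖X κ s‖ ^ 2 ∂P ≤ C)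
    {a b : ℝ} (ha : 1 ≤ a) (hab : a ≤ b) :
    Integrable (fun s => (∫ κ in a..b, ‖X κ s‖) ^ 2) P ∧
      ∫ s, (∫ κ in a..b, ‖X κ s‖) ^ 2 ∂P ≤ C * (b - a) ^ 2 := by
  simp_rw [intervalIntegral.integral_of_le hab]
  set μ : Measure ℝ := volume.restrict (Ioc a b) with hμ
  have hmem : ∀ᵐ κ ∂μ, 1 ≤ κ := by
    filter_upwards [ae_restrict_mem measurableSet_Ioc] with κ hκ using ha.trans hκ.1.le
  have hY : Measurable (Function.uncurry fun κ s => ((‖X κ s‖ : ℝ) : ℂ)) :=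
    Complex.measurable_ofReal.comp hX.norm
  have hYY : ∀ κ κ' : ℝ, 1 ≤ κ → 1 ≤ κ' →
      ‖∫ s, ((‖X κ s‖ : ℝ) : ℂ) * conj ((‖X κ' s‖ : ℝ) : ℂ) ∂P‖ ≤ C := by
    intro κ κ' hκ hκ'
    have i1 := (hL2 κ hκ).integrable_norm_pow (by norm_num)
    have i2 := (hL2 κ' hκ').integrable_norm_pow (by norm_num)
    calc _ ≤ ∫ s, (‖X κ s‖ ^ 2 + ‖X κ' s‖ ^ 2) / 2 ∂P := by
          refine norm_integral_le_of_norm_le ((i1.add i2).div_const 2) (ae_of_all _ fun s => ?_)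
          simp only [norm_mul, RCLike.norm_conj, Complex.norm_real, norm_norm]
          nlinarith [sq_nonneg (‖X κ s‖ - ‖X κ' s‖)]
      _ ≤ C := by
          rw [integral_div, integral_add i1 i2]
          linarith [hC κ hκ, hC κ' hκ']
  obtain ⟨h1, h2⟩ := integrable_norm_sq_integral (μ := μ) hY
    (hmem.mono fun κ hκ => (hL2 κ hκ).norm.ofReal)
    (hmem.mono fun κ hκ => by simpa using hC κ hκ) (K := fun _ _ => C)
    (hmem.mono fun κ hκ => hmem.mono fun κ' hκ' => hYY κ κ' hκ hκ') measurable_const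
    (integrable_const C)
  have he : ∀ s, ‖∫ κ, ((‖X κ s‖ : ℝ) : ℂ) ∂μ‖ ^ 2 = (∫ κ, ‖X κ s‖ ∂μ) ^ 2 := fun s => by
    rw [integral_complex_ofReal, Complex.norm_real, Real.norm_eq_abs, sq_abs]
  simp_rw [he] at h1 h2
  refine ⟨h1, h2.trans_eq ?_⟩
  simp only [integral_const, hμ, measureReal_restrict_apply_univ, Real.volume_real_Ioc_of_le hab,
    smul_eq_mul]
  ring

/-- A strong law of large numbers: a process with square integrably decaying correlations averages
to zero almost surely. -/
theorem ae_tendsto_average [IsProbabilityMeasure P]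
    {X : ℝ → Ω → ℂ} (hX : Measurable (Function.uncurry X)) {C : ℝ}
    (hL2 : ∀ κ ≥ 1, MemLp (X κ) 2 P)
    (hC : ∀ κ ≥ 1, ∀ κ' ≥ 1, ‖∫ s, X κ s * conj (X κ' s) ∂P‖ ≤ C * (1 + (κ - κ') ^ 2)⁻¹)
    (hi : ∀ᵐ s ∂P, ∀ Q ≥ 1, IntervalIntegrable (fun κ => X κ s) volume 1 Q) :
    ∀ᵐ s ∂P, Tendsto (fun Q : ℝ => ((1 / Q : ℝ) : ℂ) * ∫ κ in (1 : ℝ)..Q, X κ s) atTop (𝓝 0) := by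
  have hsq : ∀ κ ≥ 1, ∫ s, ‖X κ s‖ ^ 2 ∂P ≤ C := fun κ hκ => by
    have h := hC κ hκ κ hκ
    have h2 : ∫ s, X κ s * conj (X κ s) ∂P = ((∫ s, ‖X κ s‖ ^ 2 ∂P : ℝ) : ℂ) := by
      rw [← integral_complex_ofReal]
      simp_rw [Complex.mul_conj, Complex.normSq_eq_norm_sq]
    rw [h2, Complex.norm_real, Real.norm_eq_abs] at h
    simpa using (le_abs_self _).trans h
  have hC0 : 0 ≤ C := (integral_nonneg fun s => sq_nonneg _).trans (hsq 1 le_rfl)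
  -- Squares are sparse enough for the variances Cπ/q n of the averages to be summable. They are
  -- dense enough for the gaps, at most 3(n + 1), to contribute at most 9C/(n + 1)², again summable.
  let q : ℕ → ℝ := fun n => ((n : ℝ) + 1) ^ 2
  have hq1 : ∀ n, 1 ≤ q n := fun n => one_le_pow₀ (by linarith [n.cast_nonneg (α := ℝ)])
  have hqm : ∀ n, q n ≤ q (n + 1) := fun n => by
    simp only [q]; push_cast; nlinarith [n.cast_nonneg (α := ℝ)]
  have hsum : Summable fun n : ℕ => (1 : ℝ) / ((n : ℝ) + 1) ^ 2 := by
    have := (summable_nat_add_iff 1).2 (Real.summable_one_div_nat_pow.2 (by norm_num : 1 < 2))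
    simpa using this
  have h1 := ae_tendsto_zero_of_summable_integral (P := P)
    (Z := fun n s => ‖∫ κ in (1 : ℝ)..q n, X κ s‖ ^ 2 / q n ^ 2)
    (c := fun n => C * Real.pi * (1 / ((n : ℝ) + 1) ^ 2))
    (fun n => (integral_norm_sq_intervalIntegral_le hX hL2 hC le_rfl (hq1 n)).1.div_const _)
    (fun n s => by positivity)
    (fun n => by
      rw [integral_div, div_le_iff₀ (by have := hq1 n; positivity)]
      refine (integral_norm_sq_intervalIntegral_le hX hL2 hC le_rfl (hq1 n)).2.trans ?_
      have hpos : (0 : ℝ) < (n : ℝ) + 1 := by positivity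
      have : C * Real.pi * (1 / ((n : ℝ) + 1) ^ 2) * q n ^ 2 = C * Real.pi * q n := by
        simp only [q]; field_simp
      rw [this]
      have := Real.pi_pos
      gcongr
      linarith)
    (hsum.mul_left _)
  have h2 := ae_tendsto_zero_of_summable_integral (P := P)
    (Z := fun n s => (∫ κ in (q n)..(q (n + 1)), ‖X κ s‖) ^ 2 / q n ^ 2)
    (c := fun n => C * 9 * (1 / ((n : ℝ) + 1) ^ 2))
    (fun n => (integral_sq_intervalIntegral_norm_le hX hL2 hsq (hq1 n) (hqm n)).1.div_const _)
    (fun n s => by positivity)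
    (fun n => by
      rw [integral_div, div_le_iff₀ (by have := hq1 n; positivity)]
      refine (integral_sq_intervalIntegral_norm_le hX hL2 hsq (hq1 n) (hqm n)).2.trans ?_
      have hpos : (0 : ℝ) < (n : ℝ) + 1 := by positivity
      have : C * 9 * (1 / ((n : ℝ) + 1) ^ 2) * q n ^ 2 = C * (3 * ((n : ℝ) + 1)) ^ 2 := by
        simp only [q]; field_simp; ring
      rw [this]
      have hle : q (n + 1) - q n ≤ 3 * ((n : ℝ) + 1) := by
        simp only [q]; push_cast; nlinarith [n.cast_nonneg (α := ℝ)]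
      have h0 : 0 ≤ q (n + 1) - q n := sub_nonneg.2 (hqm n)
      gcongr)
    (hsum.mul_left _)
  filter_upwards [h1, h2, hi] with s hs1 hs2 his
  have hs1' : Tendsto (fun n => ‖∫ κ in (1 : ℝ)..q n, X κ s‖ / q n) atTop (𝓝 0) := by
    have := hs1.sqrt
    simp only [Real.sqrt_zero, ← div_pow] at this
    refine this.congr fun n => Real.sqrt_sq (by have := hq1 n; positivity)
  have hs2' : Tendsto (fun n => (∫ κ in (q n)..(q (n + 1)), ‖X κ s‖) / q n) atTop (𝓝 0) := by
    have := hs2.sqrt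
    simp only [Real.sqrt_zero, ← div_pow] at this
    refine this.congr fun n => Real.sqrt_sq (div_nonneg ?_ (by linarith [hq1 n]))
    exact intervalIntegral.integral_nonneg (hqm n) fun κ _ => norm_nonneg _
  have hs3 := hs1'.add hs2'
  rw [add_zero] at hs3
  -- The index with q (N Q) ≤ Q ≤ q (N Q + 1).
  let N : ℝ → ℕ := fun Q => ⌊Real.sqrt Q - 1⌋₊
  have hN : Tendsto N atTop atTop :=
    tendsto_nat_floor_atTop.comp (tendsto_atTop_add_const_right _ (-1) Real.tendsto_sqrt_atTop)
  rw [tendsto_zero_iff_norm_tendsto_zero]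
  refine squeeze_zero' (Eventually.of_forall fun Q => norm_nonneg _) ?_ (hs3.comp hN)
  filter_upwards [eventually_ge_atTop 1] with Q hQ
  have hsq1 : 1 ≤ Real.sqrt Q := Real.one_le_sqrt.2 hQ
  have hlo : q (N Q) ≤ Q := by
    have h := Nat.floor_le (sub_nonneg.2 hsq1)
    calc q (N Q) ≤ (Real.sqrt Q) ^ 2 := by
          simp only [q]; gcongr; linarith
      _ = Q := Real.sq_sqrt (by linarith)
  have hhi : Q ≤ q (N Q + 1) := by
    have h := (Nat.lt_floor_add_one (Real.sqrt Q - 1)).le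
    calc Q = (Real.sqrt Q) ^ 2 := (Real.sq_sqrt (by linarith)).symm
      _ ≤ q (N Q + 1) := by
          simp only [q]; push_cast; gcongr; linarith
  have i1 := his _ (hq1 (N Q))
  have i2 := his Q hQ
  have i3 := his _ (hq1 (N Q + 1))
  have i4 : IntervalIntegrable (fun κ => X κ s) volume (q (N Q)) Q := i1.symm.trans i2
  have i5 : IntervalIntegrable (fun κ => X κ s) volume (q (N Q)) (q (N Q + 1)) := i1.symm.trans i3
  have hsplit : ∫ κ in (1 : ℝ)..Q, X κ s =
      (∫ κ in (1 : ℝ)..q (N Q), X κ s) + ∫ κ in (q (N Q))..Q, X κ s :=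
    (intervalIntegral.integral_add_adjacent_intervals i1 i4).symm
  have hb : ‖∫ κ in (q (N Q))..Q, X κ s‖ ≤ ∫ κ in (q (N Q))..(q (N Q + 1)), ‖X κ s‖ :=
    (intervalIntegral.norm_integral_le_integral_norm hlo).trans
      (intervalIntegral.integral_mono_interval le_rfl hlo hhi
        (ae_of_all _ fun κ => norm_nonneg _) i5.norm)
  have hb0 := (norm_nonneg _).trans hb
  have hq0 : 0 < q (N Q) := by linarith [hq1 (N Q)]
  simp only [Function.comp_apply]
  rw [norm_mul, Complex.norm_real, Real.norm_eq_abs, abs_of_pos (by positivity), hsplit, ← add_div,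
    div_mul_eq_mul_div, one_mul]
  gcongr
  exact (norm_add_le _ _).trans (add_le_add le_rfl hb)

theorem tendsto_average_of_tendsto {g : ℝ → ℂ} {L : ℂ} (hg : Tendsto g atTop (𝓝 L))
    (hi : ∀ Q ≥ 1, IntervalIntegrable g volume 1 Q) :
    Tendsto (fun Q : ℝ => ((1 / Q : ℝ) : ℂ) * ∫ κ in Q..(2 * Q), g κ) atTop (𝓝 L) := by
  rw [Metric.tendsto_atTop] at hg ⊢
  intro ε hε
  obtain ⟨M, hM⟩ := hg (ε / 2) (by positivity)
  refine ⟨max M 1, fun Q hQ => ?_⟩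
  have hQ1 : 1 ≤ Q := (le_max_right _ _).trans hQ
  have hQM : M ≤ Q := (le_max_left _ _).trans hQ
  have hQ0 : (Q : ℂ) ≠ 0 := by exact_mod_cast (by linarith : Q ≠ 0)
  have hint : IntervalIntegrable g volume Q (2 * Q) :=
    (hi Q hQ1).symm.trans (hi (2 * Q) (by linarith))
  have hL : L = ((1 / Q : ℝ) : ℂ) * ∫ _ in Q..(2 * Q), L := by
    rw [intervalIntegral.integral_const, Complex.real_smul]
    push_cast; field_simp; ring
  have hb : ‖∫ κ in Q..(2 * Q), (g κ - L)‖ ≤ ε / 2 * |2 * Q - Q| := by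
    refine intervalIntegral.norm_integral_le_of_norm_le_const fun κ hκ => ?_
    rw [uIoc_of_le (by linarith)] at hκ
    have := hM κ (hQM.trans hκ.1.le)
    rw [dist_eq_norm] at this
    exact this.le
  rw [dist_eq_norm]
  conv_lhs => rw [hL, ← mul_sub, ← intervalIntegral.integral_sub hint intervalIntegrable_const]
  rw [norm_mul, Complex.norm_real, Real.norm_eq_abs, abs_of_pos (by positivity)]
  rw [show 2 * Q - Q = Q by ring, abs_of_pos (by linarith)] at hb
  calc 1 / Q * ‖∫ κ in Q..(2 * Q), (g κ - L)‖ ≤ 1 / Q * (ε / 2 * Q) := by gcongr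
    _ = ε / 2 := by field_simp
    _ < ε := by linarith

/-- Gaussian laws give only almost everywhere measurability at each κ, whereas Fubini needs joint
measurability. Measurable versions at rational κ agree with U off one null set; V is set to zero
there, and continuity in κ carries measurability to all real κ. -/
theorem exists_measurable_modification {U : ℝ → Ω → ℂ} (hU : ∀ s, Continuous fun κ => U κ s)
    (hm : ∀ κ, AEMeasurable (U κ) P) :
    ∃ V : ℝ → Ω → ℂ, Measurable (Function.uncurry V) ∧ (∀ s, Continuous fun κ => V κ s) ∧
      ∀ᵐ s ∂P, ∀ κ, V κ s = U κ s := by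
  have h1 : ∀ᵐ s ∂P, ∀ r : ℚ, U r s = (hm r).mk _ s := ae_all_iff.2 fun r => (hm r).ae_eq_mk
  let M : Set Ω := (toMeasurable P {s | ¬ ∀ r : ℚ, U r s = (hm r).mk _ s})ᶜ
  have hM : MeasurableSet M := (measurableSet_toMeasurable _ _).compl
  have hMa : ∀ᵐ s ∂P, s ∈ M := by
    rw [ae_iff]
    simpa [M, measure_toMeasurable] using ae_iff.1 h1
  have hMe : ∀ s ∈ M, ∀ r : ℚ, U r s = (hm r).mk _ s := fun s hs => by
    by_contra h
    exact hs (subset_toMeasurable _ _ h)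
  let V : ℝ → Ω → ℂ := fun κ => M.indicator (U κ)
  have hVc : ∀ s, Continuous fun κ => V κ s := fun s => by
    by_cases hs : s ∈ M
    · simpa [V, hs] using hU s
    · simpa [V, hs] using continuous_const
  have hVq : ∀ r : ℚ, Measurable (V r) := fun r => by
    have : V r = M.indicator ((hm r).mk _) := by
      ext s
      by_cases hs : s ∈ M
      · simp [V, hs, hMe s hs r]
      · simp [V, hs]
    rw [this]
    exact (hm r).measurable_mk.indicator hM
  have hVm : ∀ κ, Measurable (V κ) := fun κ => by
    obtain ⟨r, hr, hrκ⟩ := mem_closure_iff_seq_limit.1 (Rat.denseRange_cast (𝕜 := ℝ) κ)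
    choose p hp using hr
    refine measurable_of_tendsto_metrizable (f := fun n => V (p n)) (fun n => hVq _) ?_
    rw [tendsto_pi_nhds]
    intro s
    simp_rw [hp]
    exact ((hVc s).tendsto κ).comp hrκ
  refine ⟨V, measurable_uncurry_of_continuous_of_measurable hVc hVm, hVc, ?_⟩
  filter_upwards [hMa] with s hs κ
  simp [V, hs]

end Averages

/-! ### Determination of a compactly supported function by its Fourier transform on an open set. -/

theorem fourier_eq_fourierTransform (g : E3 → ℂ) (ξ : E3) :
    fourier g ξ = FourierTransform.fourier g ((2 * Real.pi)⁻¹ • ξ) := by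
  rw [Real.fourier_eq', fourier]
  refine integral_congr_ae (ae_of_all _ fun x => ?_)
  simp only [smul_eq_mul, inner_smul_right]
  congr 2
  have : (Real.pi : ℂ) ≠ 0 := by exact_mod_cast Real.pi_ne_zero
  push_cast
  field_simp

theorem continuous_fourier {g : E3 → ℂ} (hg : Integrable g) : Continuous (fourier g) := by
  unfold fourier
  refine continuous_of_dominated (fun ξ => ?_) (bound := fun x => ‖g x‖) (fun ξ => ?_) hg.norm ?_
  · exact (Continuous.aestronglyMeasurable (by fun_prop)).mul hg.aestronglyMeasurable
  · refine ae_of_all _ fun x => ?_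
    rw [norm_mul, Complex.norm_exp]
    simp
  · exact ae_of_all _ fun x => by fun_prop

theorem eq_zero_of_fourier_eq_zero {g : E3 → ℂ} (hg : Continuous g) (hgc : HasCompactSupport g)
    (h : ∀ ξ, fourier g ξ = 0) : g = 0 := by
  have hF : FourierTransform.fourier g = 0 := by
    ext w
    have := h ((2 * Real.pi) • w)
    rw [fourier_eq_fourierTransform, smul_smul, inv_mul_cancel₀ (by positivity), one_smul] at this
    exact this
  have h1 := hg.fourierInv_fourier_eq (hg.integrable_of_hasCompactSupport hgc)
    (by rw [hF]; exact integrable_zero _ _ _)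
  rw [← h1, hF]
  ext w
  simp [Real.fourierInv_eq']

/-- Compact support makes the transform entire along the complex line ξ + zη: the exponential has
modulus e^{Im z ⟨x, η⟩}, bounded for x in the support and z in a ball, which permits differentiation
under the integral. -/
theorem differentiable_fourier_line {g : E3 → ℂ} (hg : Continuous g) (hgc : HasCompactSupport g)
    (ξ η : E3) : Differentiable ℂ fun z : ℂ =>
      ∫ x, Complex.exp (-(Complex.I * ((inner ℝ x ξ : ℝ) + z * (inner ℝ x η : ℝ)))) * g x := by
  intro z₀
  obtain ⟨R, hR⟩ := hgc.isCompact.isBounded.exists_norm_le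
  let F : ℂ → E3 → ℂ := fun z x =>
    Complex.exp (-(Complex.I * ((inner ℝ x ξ : ℝ) + z * (inner ℝ x η : ℝ)))) * g x
  let F' : ℂ → E3 → ℂ := fun z x =>
    Complex.exp (-(Complex.I * ((inner ℝ x ξ : ℝ) + z * (inner ℝ x η : ℝ)))) *
      (-(Complex.I * (inner ℝ x η : ℝ))) * g x
  have hFc : ∀ z, Continuous (F z) := fun z => by fun_prop
  have hF'c : ∀ z, Continuous (F' z) := fun z => by fun_prop
  have hFs : ∀ z, HasCompactSupport (F z) := fun z => hgc.mul_left
  have hder : ∀ x z, HasDerivAt (fun z => F z x) (F' z x) z := fun x z => by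
    have h1 : HasDerivAt (fun z : ℂ => -(Complex.I * ((inner ℝ x ξ : ℝ) + z * (inner ℝ x η : ℝ))))
        (-(Complex.I * (inner ℝ x η : ℝ))) z := by
      refine ((((hasDerivAt_id z).mul_const ((inner ℝ x η : ℝ) : ℂ)).const_add
        ((inner ℝ x ξ : ℝ) : ℂ)).const_mul Complex.I).neg.congr_deriv ?_
      rw [one_mul]
    exact h1.cexp.mul_const _
  have hb : ∀ x, ∀ z ∈ Metric.ball z₀ 1, ‖F' z x‖ ≤
      Real.exp ((‖z₀‖ + 1) * (|R| * ‖η‖)) * (|R| * ‖η‖) * ‖g x‖ := fun x z hz => by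
    by_cases hx : x ∈ tsupport g
    · have hz' : ‖z‖ ≤ ‖z₀‖ + 1 := by
        rw [mem_ball_iff_norm] at hz
        linarith [norm_le_norm_add_norm_sub' z z₀]
      have hin : |inner ℝ x η| ≤ |R| * ‖η‖ :=
        (abs_real_inner_le_norm x η).trans (by gcongr; exact (hR x hx).trans (le_abs_self R))
      simp only [F', norm_mul, norm_neg, Complex.norm_I, one_mul, Complex.norm_real,
        Real.norm_eq_abs, Complex.norm_exp]
      gcongr
      have : (-(Complex.I * ((inner ℝ x ξ : ℝ) + z * (inner ℝ x η : ℝ)))).re =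
          z.im * inner ℝ x η := by simp
      rw [this]
      calc z.im * inner ℝ x η ≤ |z.im| * |inner ℝ x η| := by
            rw [← abs_mul]; exact le_abs_self _
        _ ≤ (‖z₀‖ + 1) * (|R| * ‖η‖) := by
            gcongr
            exact (Complex.abs_im_le_norm z).trans hz'
    · simp [F', image_eq_zero_of_notMem_tsupport hx]
  have := hasDerivAt_integral_of_dominated_loc_of_deriv_le (F := F) (F' := F') (μ := volume)
    (Metric.ball_mem_nhds z₀ one_pos)
    (Eventually.of_forall fun z => (hFc z).aestronglyMeasurable)
    ((hFc z₀).integrable_of_hasCompactSupport (hFs z₀))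
    (hF'c z₀).aestronglyMeasurable (ae_of_all _ hb)
    ((hg.integrable_of_hasCompactSupport hgc).norm.const_mul _)
    (ae_of_all _ fun x z _ => hder x z)
  exact this.2.differentiableAt

/-- The identity theorem is applied on the complex line from a point ξ₀ of U (z = 0) to an arbitrary
ξ (z = 1). -/
theorem eq_zero_of_fourier_eq_zero_on {g : E3 → ℂ} (hg : Continuous g) (hgc : HasCompactSupport g)
    {U : Set E3} (hU : IsOpen U) (hne : U.Nonempty) (h : ∀ ξ ∈ U, fourier g ξ = 0) : g = 0 := by
  refine eq_zero_of_fourier_eq_zero hg hgc fun ξ => ?_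
  obtain ⟨ξ₀, hξ₀⟩ := hne
  let F : ℂ → ℂ := fun z =>
    ∫ x, Complex.exp (-(Complex.I * ((inner ℝ x ξ₀ : ℝ) + z * (inner ℝ x (ξ - ξ₀) : ℝ)))) * g x
  have hF : AnalyticOnNhd ℂ F univ :=
    ((differentiable_fourier_line hg hgc ξ₀ (ξ - ξ₀)).differentiableOn).analyticOnNhd isOpen_univ
  have hval : ∀ t : ℝ, F t = fourier g (ξ₀ + t • (ξ - ξ₀)) := fun t => by
    simp only [F, fourier]
    refine integral_congr_ae (ae_of_all _ fun x => ?_)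
    simp only [inner_add_right, inner_smul_right]
    push_cast; rfl
  have hev : ∀ᶠ t : ℝ in 𝓝[≠] 0, F t = 0 := by
    have hc : Continuous fun t : ℝ => ξ₀ + t • (ξ - ξ₀) := by fun_prop
    have : ∀ᶠ t : ℝ in 𝓝 0, ξ₀ + t • (ξ - ξ₀) ∈ U :=
      hc.continuousAt.preimage_mem_nhds (hU.mem_nhds (by simpa using hξ₀))
    filter_upwards [nhdsWithin_le_nhds this] with t ht
    rw [hval, h _ ht]
  have hfr : ∃ᶠ z : ℂ in 𝓝[≠] 0, F z = 0 := by
    have ht : Tendsto (fun t : ℝ => (t : ℂ)) (𝓝[≠] 0) (𝓝[≠] 0) := by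
      refine tendsto_nhdsWithin_iff.2 ⟨?_, ?_⟩
      · exact (Complex.continuous_ofReal.tendsto' 0 0 rfl).mono_left nhdsWithin_le_nhds
      · filter_upwards [self_mem_nhdsWithin] with t ht
        simpa using ht
    exact ht.frequently hev.frequently
  have := hF.eqOn_zero_of_preconnected_of_frequently_eq_zero isPreconnected_univ (mem_univ 0) hfr
    (mem_univ (1 : ℂ))
  have h1 := hval 1
  rw [Complex.ofReal_one, one_smul, add_sub_cancel] at h1
  rw [← h1]; exact this

/-- Continuity extends the vanishing from the dense set S to all of Θ. Polar coordinates are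
continuous off the origin, so Θ corresponds to an open set of frequencies; it is nonempty because an
open Θ cannot lie inside τ = 0. -/
theorem eq_zero_of_fourier_eq_zero_polar {g : E3 → ℂ} (hg : Continuous g)
    (hgc : HasCompactSupport g) {Θ S : Set (ℝ≥0 × Metric.sphere (0 : E3) 1)} (hΘ : IsOpen Θ)
    (hne : Θ.Nonempty) (hS : Dense S)
    (h : ∀ p ∈ Θ ∩ S, fourier g ((p.1 : ℝ) • (p.2 : E3)) = 0) : g = 0 := by
  have hcont := continuous_fourier (hg.integrable_of_hasCompactSupport hgc)
  have hall : ∀ p ∈ Θ, fourier g ((p.1 : ℝ) • (p.2 : E3)) = 0 := fun p hp => by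
    have hcl : IsClosed {p : ℝ≥0 × Metric.sphere (0 : E3) 1 |
        fourier g ((p.1 : ℝ) • (p.2 : E3)) = 0} :=
      isClosed_eq (hcont.comp (by fun_prop)) continuous_const
    exact hcl.closure_subset_iff.2 h (hS.open_subset_closure_inter hΘ hp)
  let Ψ : {ξ : E3 // ξ ≠ 0} → ℝ≥0 × Metric.sphere (0 : E3) 1 := fun ξ =>
    (‖(ξ : E3)‖₊, ⟨‖(ξ : E3)‖⁻¹ • (ξ : E3), by
      rw [mem_sphere_zero_iff_norm, norm_smul, norm_inv, norm_norm,
        inv_mul_cancel₀ (norm_ne_zero_iff.2 ξ.2)]⟩)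
  have hΨ : Continuous Ψ := by
    refine (continuous_nnnorm.comp continuous_subtype_val).prodMk (Continuous.subtype_mk ?_ _)
    exact ((continuous_norm.comp continuous_subtype_val).inv₀
      fun ξ => norm_ne_zero_iff.2 ξ.2).smul continuous_subtype_val
  have hopen : IsOpen (Subtype.val '' (Ψ ⁻¹' Θ)) :=
    isOpen_ne.isOpenMap_subtype_val _ (hΘ.preimage hΨ)
  refine eq_zero_of_fourier_eq_zero_on hg hgc hopen ?_ ?_
  · obtain ⟨⟨τ, x⟩, hτx⟩ := hne
    have hsl : IsOpen {t : ℝ≥0 | (t, x) ∈ Θ} := hΘ.preimage (by fun_prop)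
    obtain ⟨t, ht, ht0⟩ := (dense_compl_singleton (0 : ℝ≥0)).inter_open_nonempty _ hsl ⟨τ, hτx⟩
    have ht0' : (t : ℝ) ≠ 0 := by exact_mod_cast ht0
    have hx : ‖(x : E3)‖ = 1 := by simp
    have hx0 : (x : E3) ≠ 0 := by rw [← norm_ne_zero_iff, hx]; exact one_ne_zero
    refine ⟨(t : ℝ) • (x : E3), ⟨⟨(t : ℝ) • (x : E3), smul_ne_zero ht0' hx0⟩, ?_, rfl⟩⟩
    have : Ψ ⟨(t : ℝ) • (x : E3), smul_ne_zero ht0' hx0⟩ = (t, x) := by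
      refine Prod.ext ?_ (Subtype.ext ?_)
      · apply NNReal.eq
        simp [Ψ, norm_smul, hx]
      · simp [Ψ, norm_smul, hx, smul_smul, ht0']
    rw [mem_preimage, this]; exact ht
  · rintro _ ⟨ξ, hξ, rfl⟩
    have := hall _ hξ
    simpa [Ψ, smul_smul, mul_inv_cancel₀ (norm_ne_zero_iff.2 ξ.2)] using this

/-! ### Decay of Fourier transforms, Peetre's inequality and Fourier inversion. -/

theorem IsTestOn.integrable {D : Set E3} {g : E3 → ℂ} (hg : IsTestOn D g) : Integrable g :=
  hg.1.continuous.integrable_of_hasCompactSupport hg.2.1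

theorem IsTestOn.eq_zero {D : Set E3} {g : E3 → ℂ} (hg : IsTestOn D g) {x : E3} (hx : x ∉ D) :
    g x = 0 :=
  image_eq_zero_of_notMem_tsupport fun h => hx (hg.2.2 h)

/-- The constant c depends on D and n alone and the bound is linear in M. This uniformity allows
application to σ(·, ξ) with the frequency ξ as a parameter. -/
theorem exists_fourier_decay {D : Set E3} (hDb : Bornology.IsBounded D)
    (n : ℕ) : ∃ c : ℝ, 0 ≤ c ∧ ∀ (g : E3 → ℂ) (M : ℝ), IsTestOn D g →
      (∀ p ≤ n, ∀ x, ‖iteratedFDeriv ℝ p g x‖ ≤ M) →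
      ∀ ζ, ‖fourier g ζ‖ ≤ c * M * ((1 + ‖ζ‖) ^ n)⁻¹ := by
  set V : ℝ := volume.real D with hV
  have hV0 : 0 ≤ V := measureReal_nonneg
  have hfin : volume D ≠ ⊤ := hDb.measure_lt_top.ne
  refine ⟨2 ^ n * (V + (2 * Real.pi) ^ n * (2 ^ n * ((n + 1) * V))), by positivity,
    fun g M hg hM ζ => ?_⟩
  have hM0 : 0 ≤ M := (norm_nonneg _).trans (hM 0 (Nat.zero_le _) 0)
  have hbd : ∀ p ≤ n, Integrable (fun x => ‖iteratedFDeriv ℝ p g x‖) ∧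
      ∫ x, ‖iteratedFDeriv ℝ p g x‖ ≤ V * M := fun p hp => by
    have hc : Continuous (iteratedFDeriv ℝ p g) :=
      hg.1.continuous_iteratedFDeriv (by exact_mod_cast le_top)
    have hcs : HasCompactSupport (iteratedFDeriv ℝ p g) := hg.2.1.iteratedFDeriv p
    have hz : ∀ x ∉ D, ‖iteratedFDeriv ℝ p g x‖ = 0 := fun x hx => by
      rw [norm_eq_zero]
      exact image_eq_zero_of_notMem_tsupport fun h =>
        hx (hg.2.2 (tsupport_iteratedFDeriv_subset p h))
    have hi : Integrable (fun x => ‖iteratedFDeriv ℝ p g x‖) :=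
      (hc.integrable_of_hasCompactSupport hcs).norm
    refine ⟨hi, ?_⟩
    rw [← setIntegral_eq_integral_of_forall_compl_eq_zero hz]
    calc ∫ x in D, ‖iteratedFDeriv ℝ p g x‖ ≤ ∫ _ in D, M :=
          integral_mono hi.integrableOn (integrableOn_const hfin) (hM p hp)
      _ = V * M := by rw [setIntegral_const, smul_eq_mul]
  have h0 : ‖fourier g ζ‖ ≤ V * M := by
    refine (norm_integral_le_integral_norm _).trans ?_
    have := (hbd 0 (Nat.zero_le _)).2
    simp only [norm_iteratedFDeriv_zero] at this
    refine le_trans (le_of_eq ?_) this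
    refine integral_congr_ae (ae_of_all _ fun x => ?_)
    simp only
    rw [norm_mul, Complex.norm_exp]
    simp
  have h1 : ‖ζ‖ ^ n * ‖fourier g ζ‖ ≤ (2 * Real.pi) ^ n * (2 ^ n * ((n + 1) * V)) * M := by
    have h := Real.pow_mul_norm_iteratedFDeriv_fourier_le (K := 0) (N := n) (f := g)
      (hg.1.of_le (by exact_mod_cast le_top)) (fun k p hk hp => by
        have hk0 : k = 0 := by exact_mod_cast nonpos_iff_eq_zero.1 hk
        subst hk0
        simpa using (hbd p (by exact_mod_cast hp)).1) (k := 0) (n := n) le_rfl le_rfl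
      ((2 * Real.pi)⁻¹ • ζ)
    rw [norm_iteratedFDeriv_zero, ← fourier_eq_fourierTransform, norm_smul, mul_pow, norm_inv,
      Real.norm_eq_abs, abs_of_pos (by positivity), inv_pow] at h
    have hs : ∑ p ∈ Finset.range (0 + 1) ×ˢ Finset.range (n + 1),
        ∫ v, ‖v‖ ^ p.1 * ‖iteratedFDeriv ℝ p.2 g v‖ ≤ (n + 1) * (V * M) := by
      rw [Finset.sum_product]
      simp only [zero_add, Finset.range_one, Finset.sum_singleton, pow_zero, one_mul]
      refine (Finset.sum_le_card_nsmul _ _ (V * M) fun p hp => ?_).trans_eq ?_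
      · exact (hbd p (by simpa [Nat.lt_succ_iff] using hp)).2
      · simp
    have h2 : ((2 * Real.pi) ^ n)⁻¹ * ‖ζ‖ ^ n * ‖fourier g ζ‖ ≤ 2 ^ n * ((n + 1) * (V * M)) := by
      refine h.trans ?_
      simp only [pow_zero, one_mul, Nat.cast_zero, mul_zero, zero_add]
      gcongr
    rw [mul_assoc, inv_mul_le_iff₀ (by positivity)] at h2
    linarith
  have h2 : (1 + ‖ζ‖) ^ n ≤ 2 ^ n * (1 + ‖ζ‖ ^ n) := by
    rcases le_total ‖ζ‖ 1 with h | h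
    · calc (1 + ‖ζ‖) ^ n ≤ 2 ^ n := by gcongr; linarith
        _ ≤ 2 ^ n * (1 + ‖ζ‖ ^ n) := le_mul_of_one_le_right (by positivity) (by simp)
    · calc (1 + ‖ζ‖) ^ n ≤ (2 * ‖ζ‖) ^ n := by gcongr; linarith
        _ = 2 ^ n * ‖ζ‖ ^ n := mul_pow _ _ _
        _ ≤ 2 ^ n * (1 + ‖ζ‖ ^ n) := by gcongr; linarith
  rw [← div_eq_mul_inv, le_div_iff₀ (by positivity)]
  calc ‖fourier g ζ‖ * (1 + ‖ζ‖) ^ n ≤ ‖fourier g ζ‖ * (2 ^ n * (1 + ‖ζ‖ ^ n)) := by gcongr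
    _ = 2 ^ n * (‖fourier g ζ‖ + ‖ζ‖ ^ n * ‖fourier g ζ‖) := by ring
    _ ≤ 2 ^ n * (V * M + (2 * Real.pi) ^ n * (2 ^ n * ((n + 1) * V)) * M) := by gcongr
    _ = _ := by ring

/-- Peetre's inequality. -/
theorem peetre {a b c s : ℝ} (ha : 0 ≤ a) (hb : 0 ≤ b) (hc : 0 ≤ c) (hab : a ≤ b + c)
    (hba : b ≤ a + c) {k : ℕ} (hs : |s| ≤ k) : (1 + a) ^ s ≤ (1 + b) ^ s * (1 + c) ^ k := by
  have hk : (1 + c) ^ |s| ≤ (1 + c) ^ k := by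
    rw [← Real.rpow_natCast]
    exact Real.rpow_le_rpow_of_exponent_le (by linarith) hs
  refine le_trans ?_ (mul_le_mul_of_nonneg_left hk (by positivity))
  rcases le_total 0 s with h | h
  · rw [abs_of_nonneg h, ← Real.mul_rpow (by positivity) (by positivity)]
    exact Real.rpow_le_rpow (by positivity) (by nlinarith) h
  · rw [abs_of_nonpos h]
    have h1 : (1 + b) ^ (-s) ≤ ((1 + a) * (1 + c)) ^ (-s) :=
      Real.rpow_le_rpow (by positivity) (by nlinarith) (by linarith)
    rw [Real.mul_rpow (by positivity) (by positivity), Real.rpow_neg (by positivity),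
      Real.rpow_neg (by positivity)] at h1
    have hA : 0 < (1 + a) ^ s := by positivity
    have hB : 0 < (1 + b) ^ s := by positivity
    calc (1 + a) ^ s = (1 + a) ^ s * (1 + b) ^ s * ((1 + b) ^ s)⁻¹ := by field_simp
      _ ≤ (1 + a) ^ s * (1 + b) ^ s * (((1 + a) ^ s)⁻¹ * (1 + c) ^ (-s)) := by gcongr
      _ = (1 + b) ^ s * (1 + c) ^ (-s) := by field_simp

theorem peetre_norm {s : ℝ} {k : ℕ} (hs : |s| ≤ k) (ξ η : E3) :
    (1 + ‖ξ‖) ^ s ≤ (1 + ‖η‖) ^ s * (1 + ‖ξ - η‖) ^ k :=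
  peetre (norm_nonneg _) (norm_nonneg _) (norm_nonneg _)
    (by linarith [norm_le_norm_add_norm_sub' ξ η]) (by linarith [norm_le_norm_add_norm_sub ξ η]) hs

theorem exists_fourier_decay_of_contDiff {θ : E3 → ℂ} (hθ : ContDiff ℝ ∞ θ)
    (hθc : HasCompactSupport θ) (n : ℕ) :
    ∃ c : ℝ, 0 ≤ c ∧ ∀ ζ, ‖fourier θ ζ‖ ≤ c * ((1 + ‖ζ‖) ^ n)⁻¹ := by
  obtain ⟨c, hc0, hc⟩ := exists_fourier_decay (D := tsupport θ)
    hθc.isCompact.isBounded n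
  have hM : ∀ p : ℕ, ∃ M, ∀ x, ‖iteratedFDeriv ℝ p θ x‖ ≤ M := fun p =>
    (hθc.iteratedFDeriv p).exists_bound_of_continuous
      (hθ.continuous_iteratedFDeriv (by exact_mod_cast le_top))
  choose M hM using hM
  have hMs : ∀ p ≤ n, ∀ x, ‖iteratedFDeriv ℝ p θ x‖ ≤ ∑ q ∈ Finset.range (n + 1), M q :=
    fun p hp x => (hM p x).trans (Finset.single_le_sum
      (fun q _ => (norm_nonneg _).trans (hM q 0)) (by simpa [Nat.lt_succ_iff] using hp))
  exact ⟨c * ∑ q ∈ Finset.range (n + 1), M q,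
    mul_nonneg hc0 ((norm_nonneg _).trans (hMs 0 (Nat.zero_le _) 0)),
    hc θ _ ⟨hθ, hθc, subset_rfl⟩ hMs⟩

theorem integrable_inv_one_add_norm_pow_four : Integrable fun ζ : E3 => ((1 + ‖ζ‖) ^ 4)⁻¹ := by
  have := integrable_one_add_norm (E := E3) (μ := volume) (r := 4) (by simp; norm_num)
  refine this.congr (ae_of_all _ fun ζ => ?_)
  simp only
  rw [Real.rpow_neg (by positivity)]
  norm_cast

theorem integrable_fourier {θ : E3 → ℂ} (hθ : ContDiff ℝ ∞ θ) (hθc : HasCompactSupport θ) :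
    Integrable (fourier θ) := by
  obtain ⟨c, -, hc⟩ := exists_fourier_decay_of_contDiff hθ hθc 4
  refine (integrable_inv_one_add_norm_pow_four.const_mul c).mono'
    (continuous_fourier (hθ.continuous.integrable_of_hasCompactSupport hθc)).aestronglyMeasurable
    (ae_of_all _ hc)

/-- The Fourier inversion formula. -/
theorem integral_exp_mul_fourier {θ : E3 → ℂ} (hθ : ContDiff ℝ ∞ θ) (hθc : HasCompactSupport θ)
    (x : E3) : ((1 / (2 * Real.pi) ^ 3 : ℝ) : ℂ) *
      ∫ ζ, Complex.exp (Complex.I * (inner ℝ x ζ : ℝ)) * fourier θ ζ = θ x := by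
  have hF : ∀ w, FourierTransform.fourier θ w = fourier θ ((2 * Real.pi) • w) := fun w => by
    rw [fourier_eq_fourierTransform, smul_smul, inv_mul_cancel₀ (by positivity), one_smul]
  have hi : Integrable (FourierTransform.fourier θ) := by
    rw [funext hF]
    exact (integrable_fourier hθ hθc).comp_smul (by positivity)
  have h1 := hθ.continuous.fourierInv_fourier_eq (hθ.continuous.integrable_of_hasCompactSupport hθc) hi
  conv_rhs => rw [← h1, Real.fourierInv_eq']
  have h2 := Measure.integral_comp_smul (volume : Measure E3)
    (fun ζ => Complex.exp (Complex.I * (inner ℝ x ζ : ℝ)) * fourier θ ζ) (2 * Real.pi)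
  rw [finrank_euclideanSpace, Fintype.card_fin, abs_of_pos (by positivity)] at h2
  rw [one_div, ← Complex.real_smul, ← h2]
  refine integral_congr_ae (ae_of_all _ fun w => ?_)
  simp only [hF, smul_eq_mul, inner_smul_right]
  rw [real_inner_comm]
  congr 2
  push_cast; ring

/-! ### Symbol estimates and off-diagonal decay of the correlation kernel. -/

theorem IsSymbol.exists_bound {s : ℝ} {σ : E3 → E3 → ℂ} (hσ : IsSymbol s σ) (n : ℕ) :
    ∃ C : ℝ, 0 ≤ C ∧ ∀ p ≤ n, ∀ x ξ : E3,
      ‖iteratedFDeriv ℝ p (fun y => σ y ξ) x‖ ≤ C * (1 + ‖ξ‖) ^ s := by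
  choose C hC using fun p => hσ.2 p 0
  have hC' : ∀ p, ∀ x ξ : E3, ‖iteratedFDeriv ℝ p (fun y => σ y ξ) x‖ ≤ C p * (1 + ‖ξ‖) ^ s :=
    fun p x ξ => by simpa using hC p x ξ
  have hC0 : ∀ p, 0 ≤ C p := fun p => by
    have := (norm_nonneg _).trans (hC' p 0 0)
    simpa using this
  refine ⟨∑ p ∈ Finset.range (n + 1), C p, Finset.sum_nonneg fun p _ => hC0 p,
    fun p hp x ξ => (hC' p x ξ).trans ?_⟩
  gcongr
  exact Finset.single_le_sum (fun q _ => hC0 q) (by simpa [Nat.lt_succ_iff] using hp)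

theorem IsSymbol.exists_norm_le {s : ℝ} {σ : E3 → E3 → ℂ} (hσ : IsSymbol s σ) :
    ∃ C : ℝ, 0 ≤ C ∧ ∀ x ξ : E3, ‖σ x ξ‖ ≤ C * (1 + ‖ξ‖) ^ s := by
  obtain ⟨C, hC0, hC⟩ := hσ.exists_bound 0
  exact ⟨C, hC0, fun x ξ => by simpa using hC 0 le_rfl x ξ⟩

theorem IsSymbol.exists_fourier_le {s : ℝ} {σ : E3 → E3 → ℂ} {D : Set E3} (hσ : IsSymbol s σ)
    (hDb : Bornology.IsBounded D) (hσD : ∀ ξ, IsTestOn D fun x => σ x ξ) (n : ℕ) :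
    ∃ C : ℝ, 0 ≤ C ∧ ∀ ξ ζ : E3,
      ‖fourier (fun x => σ x ξ) ζ‖ ≤ C * (1 + ‖ξ‖) ^ s * ((1 + ‖ζ‖) ^ n)⁻¹ := by
  obtain ⟨C, hC0, hC⟩ := hσ.exists_bound n
  obtain ⟨c, hc0, hc⟩ := exists_fourier_decay hDb n
  refine ⟨c * C, by positivity, fun ξ ζ => ?_⟩
  have := hc _ _ (hσD ξ) (fun p hp x => hC p hp x ξ) ζ
  rwa [← mul_assoc] at this

/-- The pairing of the pseudo-differential operator with symbol `σ`, applied to `θ e^{i η·y}`,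
with `e^{-i ξ·x}`. -/
def kern (σ : E3 → E3 → ℂ) (θ : E3 → ℂ) (ξ η : E3) : ℂ :=
  ((1 / (2 * Real.pi) ^ 3 : ℝ) : ℂ) * ∫ x, ∫ ξ',
    Complex.exp (-(Complex.I * (inner ℝ x (ξ - ξ') : ℝ))) * (σ x ξ' * fourier θ (ξ' - η))

section Kernel

variable {s : ℝ} {σ : E3 → E3 → ℂ} {D : Set E3} {θ : E3 → ℂ}

theorem norm_exp_neg_I_mul (t : ℝ) : ‖Complex.exp (-(Complex.I * t))‖ = 1 := by
  rw [Complex.norm_exp]; simp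

/-- Seven powers of decay of θ̂ are used: three pay for Peetre's inequality, moving the weight from
ξ' to η, and four remain for integrability in dimension three. -/
theorem kern_integrand_le (hσ : IsSymbol s σ) (hs : |s| ≤ 3) (hθ : ContDiff ℝ ∞ θ)
    (hθc : HasCompactSupport θ) : ∃ C : ℝ, 0 ≤ C ∧ ∀ x ξ' η : E3,
      ‖σ x ξ' * fourier θ (ξ' - η)‖ ≤ C * (1 + ‖η‖) ^ s * ((1 + ‖ξ' - η‖) ^ 4)⁻¹ := by
  obtain ⟨C, hC0, hC⟩ := hσ.exists_norm_le
  obtain ⟨c, hc0, hc⟩ := exists_fourier_decay_of_contDiff hθ hθc 7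
  refine ⟨C * c, by positivity, fun x ξ' η => ?_⟩
  have hp := peetre_norm (k := 3) (by exact_mod_cast hs) ξ' η
  rw [norm_mul]
  calc ‖σ x ξ'‖ * ‖fourier θ (ξ' - η)‖
      ≤ (C * ((1 + ‖η‖) ^ s * (1 + ‖ξ' - η‖) ^ 3)) * (c * ((1 + ‖ξ' - η‖) ^ 7)⁻¹) := by
        gcongr
        · exact (hC x ξ').trans (by gcongr)
        · exact hc _
    _ = C * c * (1 + ‖η‖) ^ s * ((1 + ‖ξ' - η‖) ^ 4)⁻¹ := by
        have : 0 < 1 + ‖ξ' - η‖ := by positivity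
        field_simp

theorem IsSymbol.continuous_left {s : ℝ} {σ : E3 → E3 → ℂ} (hσ : IsSymbol s σ) (x : E3) :
    Continuous (σ x) :=
  hσ.1.continuous.comp (continuous_const.prodMk continuous_id)

theorem integrable_kern (hσ : IsSymbol s σ) (hs : |s| ≤ 3) (hD : IsOpen D)
    (hDb : Bornology.IsBounded D) (hσD : ∀ ξ, IsTestOn D fun x => σ x ξ) (hθ : ContDiff ℝ ∞ θ)
    (hθc : HasCompactSupport θ) (ξ η : E3) :
    Integrable (Function.uncurry fun x ξ' : E3 =>
      Complex.exp (-(Complex.I * (inner ℝ x (ξ - ξ') : ℝ))) * (σ x ξ' * fourier θ (ξ' - η)))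
      (volume.prod volume) := by
  obtain ⟨C, hC0, hC⟩ := kern_integrand_le hσ hs hθ hθc
  have h1 : Integrable (D.indicator fun _ => (1 : ℝ)) :=
    (integrable_indicator_iff hD.measurableSet).2 (integrableOn_const hDb.measure_lt_top.ne)
  have h2 : Integrable fun ξ' : E3 => C * (1 + ‖η‖) ^ s * ((1 + ‖ξ' - η‖) ^ 4)⁻¹ :=
    (integrable_inv_one_add_norm_pow_four.comp_sub_right η).const_mul _
  refine (h1.mul_prod h2).mono' ?_ (ae_of_all _ ?_)
  · have hf : Continuous (fourier θ) :=
      continuous_fourier (hθ.continuous.integrable_of_hasCompactSupport hθc)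
    have hσc : Continuous fun z : E3 × E3 => σ z.1 z.2 := hσ.1.continuous
    refine Continuous.aestronglyMeasurable ?_
    unfold Function.uncurry
    fun_prop
  · rintro ⟨x, ξ'⟩
    simp only [Function.uncurry]
    by_cases hx : x ∈ D
    · rw [norm_mul, norm_exp_neg_I_mul, one_mul, indicator_of_mem hx, one_mul]
      exact hC x ξ' η
    · simp [(hσD ξ').eq_zero hx, hx]

/-- The pairing is concentrated near the diagonal. -/
theorem exists_kern_le (hσ : IsSymbol s σ) (hs : |s| ≤ 3) (hD : IsOpen D)
    (hDb : Bornology.IsBounded D) (hσD : ∀ ξ, IsTestOn D fun x => σ x ξ) (hθ : ContDiff ℝ ∞ θ)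
    (hθc : HasCompactSupport θ) (n : ℕ) : ∃ C : ℝ, 0 ≤ C ∧ ∀ ξ η : E3,
      ‖kern σ θ ξ η‖ ≤ C * (1 + ‖η‖) ^ s * ((1 + ‖ξ - η‖) ^ n)⁻¹ := by
  obtain ⟨C, hC0, hC⟩ := hσ.exists_fourier_le hDb hσD n
  -- The n additional powers are spent on 1 + |ξ - η| ≤ (1 + |ξ - ξ'|)(1 + |ξ' - η|).
  obtain ⟨c, hc0, hc⟩ := exists_fourier_decay_of_contDiff hθ hθc (n + 7)
  set J : ℝ := ∫ ζ : E3, ((1 + ‖ζ‖) ^ 4)⁻¹ with hJ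
  have hJ0 : 0 ≤ J := integral_nonneg fun ζ => by positivity
  refine ⟨1 / (2 * Real.pi) ^ 3 * (C * c * J), by positivity, fun ξ η => ?_⟩
  -- Integrating over x first produces the Fourier transform of σ(·, ξ') at ξ - ξ', which decays
  -- rapidly.
  have hswap := integral_integral_swap (integrable_kern hσ hs hD hDb hσD hθ hθc ξ η)
  have hin : ∀ ξ' : E3, ∫ x, Complex.exp (-(Complex.I * (inner ℝ x (ξ - ξ') : ℝ))) *
      (σ x ξ' * fourier θ (ξ' - η)) = fourier (fun x => σ x ξ') (ξ - ξ') * fourier θ (ξ' - η) :=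
    fun ξ' => by
      conv_rhs => rw [fourier]
      rw [← integral_mul_const]
      simp only [mul_assoc]
  have hb : ∀ ξ' : E3, ‖fourier (fun x => σ x ξ') (ξ - ξ') * fourier θ (ξ' - η)‖ ≤
      C * c * (1 + ‖η‖) ^ s * ((1 + ‖ξ - η‖) ^ n)⁻¹ * ((1 + ‖ξ' - η‖) ^ 4)⁻¹ := fun ξ' => by
    have hp := peetre_norm (k := 3) (by exact_mod_cast hs) ξ' η
    have htri : 1 + ‖ξ - η‖ ≤ (1 + ‖ξ - ξ'‖) * (1 + ‖ξ' - η‖) := by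
      have := norm_sub_le_norm_sub_add_norm_sub ξ ξ' η
      nlinarith [norm_nonneg (ξ - ξ'), norm_nonneg (ξ' - η)]
    have htri' : (1 + ‖ξ - η‖) ^ n ≤ (1 + ‖ξ - ξ'‖) ^ n * (1 + ‖ξ' - η‖) ^ n := by
      rw [← mul_pow]; gcongr
    have hinv : ((1 + ‖ξ - ξ'‖) ^ n)⁻¹ * ((1 + ‖ξ' - η‖) ^ n)⁻¹ ≤ ((1 + ‖ξ - η‖) ^ n)⁻¹ := by
      rw [← mul_inv]; gcongr
    rw [norm_mul]
    calc ‖fourier (fun x => σ x ξ') (ξ - ξ')‖ * ‖fourier θ (ξ' - η)‖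
        ≤ (C * ((1 + ‖η‖) ^ s * (1 + ‖ξ' - η‖) ^ 3) * ((1 + ‖ξ - ξ'‖) ^ n)⁻¹) *
          (c * ((1 + ‖ξ' - η‖) ^ (n + 7))⁻¹) := by
          gcongr
          · exact (hC ξ' _).trans (by gcongr)
          · exact hc _
      _ = C * c * (1 + ‖η‖) ^ s * (((1 + ‖ξ - ξ'‖) ^ n)⁻¹ * ((1 + ‖ξ' - η‖) ^ n)⁻¹) *
          ((1 + ‖ξ' - η‖) ^ 4)⁻¹ := by
          have : 0 < 1 + ‖ξ' - η‖ := by positivity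
          rw [show n + 7 = n + (3 + 4) from rfl, pow_add, pow_add]
          field_simp
      _ ≤ _ := by gcongr
  unfold kern
  rw [norm_mul, Complex.norm_real, Real.norm_eq_abs, abs_of_pos (by positivity), hswap]
  simp_rw [hin]
  have hi := norm_integral_le_of_norm_le
    ((integrable_inv_one_add_norm_pow_four.comp_sub_right η).const_mul
      (C * c * (1 + ‖η‖) ^ s * ((1 + ‖ξ - η‖) ^ n)⁻¹)) (ae_of_all _ hb)
  rw [integral_const_mul, integral_sub_right_eq_self (fun ζ : E3 => ((1 + ‖ζ‖) ^ 4)⁻¹) η] at hi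
  calc 1 / (2 * Real.pi) ^ 3 *
        ‖∫ ξ', fourier (fun x => σ x ξ') (ξ - ξ') * fourier θ (ξ' - η)‖
      ≤ 1 / (2 * Real.pi) ^ 3 * (C * c * (1 + ‖η‖) ^ s * ((1 + ‖ξ - η‖) ^ n)⁻¹ * J) := by gcongr
    _ = _ := by ring

end Kernel

/-! ### Leading order of the correlation kernel on the diagonal. -/

/-- The principal part of a symbol uses c = 0, the weight of the remainder c = 1. -/
theorem tendsto_ratio_rpow {e : E3} (he : ‖e‖ = 1) (ζ : E3) (c m : ℝ) :
    Tendsto (fun κ : ℝ => κ ^ m * (c + ‖ζ + κ • e‖) ^ (-m)) atTop (𝓝 1) := by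
  have h1 : Tendsto (fun κ : ℝ => c * κ⁻¹ + ‖κ⁻¹ • ζ + e‖) atTop (𝓝 1) := by
    have h0 := tendsto_inv_atTop_zero (𝕜 := ℝ)
    have := (h0.const_mul c).add ((h0.smul_const ζ).add_const e).norm
    simpa [he] using this
  have h2 : Tendsto (fun κ : ℝ => (c * κ⁻¹ + ‖κ⁻¹ • ζ + e‖) ^ (-m)) atTop (𝓝 1) := by
    have := h1.rpow_const (p := -m) (Or.inl one_ne_zero)
    rwa [Real.one_rpow] at this
  refine h2.congr' ?_
  filter_upwards [eventually_gt_atTop 0, h1.eventually (lt_mem_nhds zero_lt_one)] with κ hκ hpos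
  have h3 : c + ‖ζ + κ • e‖ = κ * (c * κ⁻¹ + ‖κ⁻¹ • ζ + e‖) := by
    have h4 : ζ + κ • e = κ • (κ⁻¹ • ζ + e) := by
      rw [smul_add, smul_smul, mul_inv_cancel₀ hκ.ne', one_smul]
    rw [h4, norm_smul, Real.norm_eq_abs, abs_of_pos hκ]
    field_simp
  rw [h3, Real.mul_rpow hκ.le hpos.le, ← mul_assoc, ← Real.rpow_add hκ, add_neg_cancel,
    Real.rpow_zero, one_mul]

theorem tendsto_norm_add_smul {e : E3} (he : ‖e‖ = 1) (ζ : E3) :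
    Tendsto (fun κ : ℝ => ‖ζ + κ • e‖) atTop atTop := by
  refine tendsto_atTop_mono' atTop ?_ (tendsto_atTop_add_const_right _ (-‖ζ‖) tendsto_id)
  filter_upwards [eventually_ge_atTop 0] with κ hκ
  have h := norm_sub_norm_le (κ • e) (-ζ)
  rw [norm_smul, he, Real.norm_eq_abs, abs_of_nonneg hκ, norm_neg, sub_neg_eq_add, add_comm _ ζ] at h
  simp only [id]; linarith

/-- A bounded shift ζ does not affect the principal part at leading order, and the remainder is
smaller by a factor (1 + |ζ + κe|)⁻¹. -/
theorem tendsto_symbol {m : ℝ} {σ ρ : E3 → E3 → ℂ} {A : E3 → ℂ} (hρ : IsSymbol (-m - 1) ρ)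
    (h : ∀ x ξ, 1 ≤ ‖ξ‖ → σ x ξ = ((‖ξ‖ ^ (-m) : ℝ) : ℂ) * A x + ρ x ξ)
    {e : E3} (he : ‖e‖ = 1) (x ζ : E3) :
    Tendsto (fun κ : ℝ => ((κ ^ m : ℝ) : ℂ) * σ x (ζ + κ • e)) atTop (𝓝 (A x)) := by
  obtain ⟨C, hC0, hC⟩ := hρ.exists_norm_le
  have hn := tendsto_norm_add_smul he ζ
  have h1 : Tendsto (fun κ : ℝ => ((κ ^ m * ‖ζ + κ • e‖ ^ (-m) : ℝ) : ℂ) * A x) atTop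
      (𝓝 (A x)) := by
    have := (Complex.continuous_ofReal.tendsto _).comp (tendsto_ratio_rpow he ζ 0 m)
    simpa using this.mul_const (A x)
  have h2 : Tendsto (fun κ : ℝ => ((κ ^ m : ℝ) : ℂ) * ρ x (ζ + κ • e)) atTop (𝓝 0) := by
    have h3 : Tendsto (fun κ : ℝ => C * ((κ ^ m * (1 + ‖ζ + κ • e‖) ^ (-m)) *
        (1 + ‖ζ + κ • e‖)⁻¹)) atTop (𝓝 0) := by
      have := ((tendsto_ratio_rpow he ζ 1 m).mul
        (tendsto_inv_atTop_zero.comp (tendsto_atTop_add_const_left _ 1 hn))).const_mul C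
      simpa using this
    refine squeeze_zero_norm' ?_ h3
    filter_upwards [eventually_ge_atTop 0] with κ hκ
    rw [norm_mul, Complex.norm_real, Real.norm_eq_abs, abs_of_nonneg (by positivity)]
    calc κ ^ m * ‖ρ x (ζ + κ • e)‖ ≤ κ ^ m * (C * (1 + ‖ζ + κ • e‖) ^ (-m - 1)) := by
          gcongr; exact hC _ _
      _ = _ := by
          rw [Real.rpow_sub_one (by positivity)]; ring
  have h4 := h1.add h2
  rw [add_zero] at h4
  refine h4.congr' ?_
  filter_upwards [hn.eventually_ge_atTop 1] with κ hκ
  rw [h x _ hκ]; push_cast; ring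

/-- The leading order of the pairing on the diagonal. -/
theorem tendsto_kern {m : ℝ} (hm : |m| ≤ 3) {σ ρ : E3 → E3 → ℂ} {A θ : E3 → ℂ} {D : Set E3}
    (hσ : IsSymbol (-m) σ) (hρ : IsSymbol (-m - 1) ρ)
    (h : ∀ x ξ, 1 ≤ ‖ξ‖ → σ x ξ = ((‖ξ‖ ^ (-m) : ℝ) : ℂ) * A x + ρ x ξ)
    (hD : IsOpen D) (hDb : Bornology.IsBounded D) (hA : IsTestOn D A)
    (hσD : ∀ ξ, IsTestOn D fun x => σ x ξ) (hθ : ContDiff ℝ ∞ θ) (hθc : HasCompactSupport θ)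
    (hθD : ∀ x ∈ D, θ x = 1) {e : E3} (he : ‖e‖ = 1) (τ : ℝ) :
    Tendsto (fun κ : ℝ => ((κ ^ m : ℝ) : ℂ) * kern σ θ ((κ + τ) • e) (κ • e)) atTop
      (𝓝 (fourier A (τ • e))) := by
  obtain ⟨C, hC0, hC⟩ := kern_integrand_le hσ (by rwa [abs_neg]) hθ hθc
  -- The substitution ξ' = ζ + κe frees the phase and θ̂ of κ; only the rescaled symbol still
  -- depends on it, so dominated convergence applies, first in ζ and then in x.
  have hinner : ∀ (κ : ℝ) (x : E3), ((κ ^ m : ℝ) : ℂ) * ∫ ξ' : E3,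
      Complex.exp (-(Complex.I * (inner ℝ x ((κ + τ) • e - ξ') : ℝ))) *
        (σ x ξ' * fourier θ (ξ' - κ • e)) =
      ∫ ζ : E3, Complex.exp (-(Complex.I * (inner ℝ x (τ • e - ζ) : ℝ))) *
        ((((κ ^ m : ℝ) : ℂ) * σ x (ζ + κ • e)) * fourier θ ζ) := fun κ x => by
    rw [← integral_const_mul, ← integral_add_right_eq_self _ (κ • e)]
    refine integral_congr_ae (ae_of_all _ fun ζ => ?_)
    simp only [add_sub_cancel_right]
    rw [show (κ + τ) • e - (ζ + κ • e) = τ • e - ζ by rw [add_smul]; abel]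
    ring
  have hfourier : Continuous (fourier θ) :=
    continuous_fourier (hθ.continuous.integrable_of_hasCompactSupport hθc)
  have hbound : ∀ κ : ℝ, 1 ≤ κ → ∀ x ζ : E3,
      ‖Complex.exp (-(Complex.I * (inner ℝ x (τ • e - ζ) : ℝ))) *
        ((((κ ^ m : ℝ) : ℂ) * σ x (ζ + κ • e)) * fourier θ ζ)‖ ≤
      C * 8 * ((1 + ‖ζ‖) ^ 4)⁻¹ := fun κ hκ x ζ => by
    have h1 := hC x (ζ + κ • e) (κ • e)
    rw [add_sub_cancel_right, norm_smul, he, mul_one, Real.norm_eq_abs,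
      abs_of_nonneg (by linarith)] at h1
    -- Peetre's inequality with 1 + a = κ and c = 1; the constant is 2³.
    have h2 : κ ^ m ≤ (1 + κ) ^ m * 8 := by
      have := peetre (a := κ - 1) (b := κ) (c := 1) (s := m) (k := 3) (by linarith) (by linarith)
        zero_le_one (by linarith) (by linarith) (by exact_mod_cast hm)
      norm_num at this; exact this
    have h3 : κ ^ m * (1 + κ) ^ (-m) ≤ 8 := by
      rw [Real.rpow_neg (by linarith), ← div_eq_mul_inv, div_le_iff₀ (by positivity)]
      linarith
    rw [norm_mul, norm_exp_neg_I_mul, one_mul, mul_assoc, norm_mul, Complex.norm_real,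
      Real.norm_eq_abs, abs_of_nonneg (by positivity)]
    calc κ ^ m * ‖σ x (ζ + κ • e) * fourier θ ζ‖
        ≤ κ ^ m * (C * (1 + κ) ^ (-m) * ((1 + ‖ζ‖) ^ 4)⁻¹) := by gcongr
      _ = C * (κ ^ m * (1 + κ) ^ (-m)) * ((1 + ‖ζ‖) ^ 4)⁻¹ := by ring
      _ ≤ _ := by gcongr
  have hbi : Integrable fun ζ : E3 => C * 8 * ((1 + ‖ζ‖) ^ 4)⁻¹ :=
    integrable_inv_one_add_norm_pow_four.const_mul _
  have hlim1 : ∀ x, Tendsto (fun κ : ℝ => ((κ ^ m : ℝ) : ℂ) * ∫ ξ' : E3,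
      Complex.exp (-(Complex.I * (inner ℝ x ((κ + τ) • e - ξ') : ℝ))) *
        (σ x ξ' * fourier θ (ξ' - κ • e))) atTop (𝓝 (∫ ζ : E3,
      Complex.exp (-(Complex.I * (inner ℝ x (τ • e - ζ) : ℝ))) * (A x * fourier θ ζ))) := by
    intro x
    simp_rw [hinner]
    refine tendsto_integral_filter_of_dominated_convergence _ ?_ ?_ hbi ?_
    · refine Eventually.of_forall fun κ => Continuous.aestronglyMeasurable ?_
      have := hσ.continuous_left x
      fun_prop
    · filter_upwards [eventually_ge_atTop 1] with κ hκ using ae_of_all _ (hbound κ hκ x)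
    · exact ae_of_all _ fun ζ => ((tendsto_symbol hρ h he x ζ).mul_const _).const_mul _
  have hlim2 : Tendsto (fun κ : ℝ => ∫ x, ((κ ^ m : ℝ) : ℂ) * ∫ ξ' : E3,
      Complex.exp (-(Complex.I * (inner ℝ x ((κ + τ) • e - ξ') : ℝ))) *
        (σ x ξ' * fourier θ (ξ' - κ • e))) atTop (𝓝 (∫ x, ∫ ζ : E3,
      Complex.exp (-(Complex.I * (inner ℝ x (τ • e - ζ) : ℝ))) * (A x * fourier θ ζ))) := by
    refine tendsto_integral_filter_of_dominated_convergence
      (D.indicator fun _ => ∫ ζ : E3, C * 8 * ((1 + ‖ζ‖) ^ 4)⁻¹) ?_ ?_ ?_ (ae_of_all _ hlim1)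
    · exact Eventually.of_forall fun κ => (integrable_kern hσ (by rwa [abs_neg]) hD hDb hσD hθ hθc
        ((κ + τ) • e) (κ • e)).integral_prod_left.aestronglyMeasurable.const_mul _
    · filter_upwards [eventually_ge_atTop 1] with κ hκ
      refine ae_of_all _ fun x => ?_
      by_cases hx : x ∈ D
      · rw [indicator_of_mem hx, hinner]
        exact norm_integral_le_of_norm_le hbi (ae_of_all _ (hbound κ hκ x))
      · simp [(hσD _).eq_zero hx, hx]
    · exact (integrable_indicator_iff hD.measurableSet).2
        (integrableOn_const hDb.measure_lt_top.ne)
  -- In the limit the ζ-integral is Fourier inversion for θ, and θ = 1 wherever A is nonzero.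
  have hfin : ((1 / (2 * Real.pi) ^ 3 : ℝ) : ℂ) * ∫ x, ∫ ζ : E3,
      Complex.exp (-(Complex.I * (inner ℝ x (τ • e - ζ) : ℝ))) * (A x * fourier θ ζ) =
      fourier A (τ • e) := by
    rw [← integral_const_mul, fourier]
    refine integral_congr_ae (ae_of_all _ fun x => ?_)
    simp only
    have h1 : ∀ ζ : E3, Complex.exp (-(Complex.I * (inner ℝ x (τ • e - ζ) : ℝ))) *
        (A x * fourier θ ζ) = Complex.exp (-(Complex.I * (inner ℝ x (τ • e) : ℝ))) * A x *
        (Complex.exp (Complex.I * (inner ℝ x ζ : ℝ)) * fourier θ ζ) := fun ζ => by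
      rw [inner_sub_right, Complex.ofReal_sub, mul_sub, neg_sub, sub_eq_add_neg, Complex.exp_add]
      ring
    simp_rw [h1]
    rw [integral_const_mul, mul_left_comm, integral_exp_mul_fourier hθ hθc]
    by_cases hx : x ∈ D
    · rw [hθD x hx, mul_one]
    · simp [hA.eq_zero hx]
  rw [← hfin]
  refine (hlim2.const_mul _).congr fun κ => ?_
  rw [integral_const_mul, kern]
  ring

/-! ### Frequency averages of products of Gaussian processes. -/

section GaussianAverage

variable {Ω : Type*} [MeasurableSpace Ω] {P : Measure Ω} {R : Submodule ℝ (Ω → ℝ)}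

theorem rpow_le_rpow_mul_pow {m : ℝ} (hm : |m| ≤ 3) {κ κ' : ℝ} (h : 1 ≤ κ) (h' : 1 ≤ κ') :
    κ ^ m ≤ κ' ^ m * (1 + |κ - κ'|) ^ 3 := by
  have := peetre (a := κ - 1) (b := κ' - 1) (c := |κ - κ'|) (s := m) (k := 3) (by linarith)
    (by linarith) (abs_nonneg _) (by linarith [le_abs_self (κ - κ')])
    (by linarith [neg_abs_le (κ - κ')]) (by exact_mod_cast hm)
  simpa using this

/-- The average of a product of two jointly Gaussian processes whose correlations decay away from
the diagonal. -/
theorem ae_tendsto_gaussian_average [IsProbabilityMeasure P]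
    (hR : ∀ X ∈ R, HasGaussianLaw X P ∧ ∫ s, X s ∂P = 0) {m : ℝ} (hm : |m| ≤ 3) {τ : ℝ}
    (hτ : 0 ≤ τ) {a b : ℝ → Ω → ℂ}
    (ha : ∀ κ, (fun s => (a κ s).re) ∈ R ∧ (fun s => (a κ s).im) ∈ R)
    (hb : ∀ κ, (fun s => (b κ s).re) ∈ R ∧ (fun s => (b κ s).im) ∈ R)
    (ha' : ∀ κ, (fun s => (conj (a κ s)).re) ∈ R ∧ (fun s => (conj (a κ s)).im) ∈ R)
    (hb' : ∀ κ, (fun s => (conj (b κ s)).re) ∈ R ∧ (fun s => (conj (b κ s)).im) ∈ R)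
    (hac : ∀ s, Continuous fun κ => a κ s) (hbc : ∀ s, Continuous fun κ => b κ s)
    {C : ℝ} (hC0 : 0 ≤ C)
    (haa : ∀ κ ≥ 1, ∀ κ' ≥ 1, ‖∫ s, a κ s * conj (a κ' s) ∂P‖ ≤
      C * κ' ^ (-m) * ((1 + |κ - κ'|) ^ 3)⁻¹)
    (hbb : ∀ κ ≥ 1, ∀ κ' ≥ 1, ‖∫ s, b κ s * conj (b κ' s) ∂P‖ ≤
      C * κ' ^ (-m) * ((1 + |κ - κ'|) ^ 3)⁻¹)
    (hab : ∀ κ ≥ 1, ∀ κ' ≥ 1, ‖∫ s, a κ s * conj (b κ' s) ∂P‖ ≤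
      C * κ' ^ (-m) * ((1 + |κ - κ'|) ^ 3)⁻¹)
    (hba : ∀ κ ≥ 1, ∀ κ' ≥ 1, ‖∫ s, b κ s * conj (a κ' s) ∂P‖ ≤
      C * κ' ^ (-m) * ((1 + |κ - κ'|) ^ 3)⁻¹)
    {L : ℂ} (hL : Tendsto (fun κ : ℝ => ((κ ^ m : ℝ) : ℂ) * ∫ s, a κ s * b κ s ∂P) atTop (𝓝 L)) :
    ∀ᵐ s ∂P, Tendsto (fun Q : ℝ => ((1 / Q : ℝ) : ℂ) * ∫ κ in Q..(2 * Q),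
      ((κ ^ (m - 2) * ((κ + τ) * κ) : ℝ) : ℂ) * (a κ s * b κ s)) atTop (𝓝 L) := by
  have haL := fun κ => memLp_of_re_im hR (ha κ)
  have hbL := fun κ => memLp_of_re_im hR (hb κ)
  obtain ⟨Va, hVam, hVac, hVa⟩ := exists_measurable_modification (P := P) hac
    fun κ => (haL κ).aestronglyMeasurable.aemeasurable
  obtain ⟨Vb, hVbm, hVbc, hVb⟩ := exists_measurable_modification (P := P) hbc
    fun κ => (hbL κ).aestronglyMeasurable.aemeasurable
  let w : ℝ → ℝ := fun κ => κ ^ (m - 2) * ((κ + τ) * κ)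
  -- Up to constants, the weight κ^{m-2} times the factor (κ + τ)κ of the two far fields is κ^m(1 +
  -- τ/κ), which matches the size κ^{-m} of the correlations.
  have hw : ∀ κ ≥ 1, w κ = κ ^ m * (1 + τ * κ⁻¹) := fun κ hκ => by
    have hκ0 : 0 < κ := by linarith
    simp only [w]
    rw [Real.rpow_sub hκ0, Real.rpow_two]
    field_simp
  have hw0 : ∀ κ ≥ 1, 0 ≤ w κ := fun κ hκ => by
    rw [hw κ hκ]; have : 0 < κ := by linarith
    positivity
  have hw1 : ∀ κ ≥ 1, w κ ≤ κ ^ m * (1 + τ) := fun κ hκ => by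
    rw [hw κ hκ]
    have : τ * κ⁻¹ ≤ τ := mul_le_of_le_one_right hτ (inv_le_one_of_one_le₀ hκ)
    have h0 : 0 < κ := by linarith
    gcongr
  have hwm : Measurable w := by fun_prop
  have hwc : ContinuousOn w (Ici 1) := by
    refine ContinuousOn.mul (continuousOn_id.rpow_const fun κ hκ => Or.inl ?_) (by fun_prop)
    have : (1 : ℝ) ≤ κ := hκ
    simp only [id]; linarith
  let μ : ℝ → ℂ := fun κ => ∫ s, a κ s * b κ s ∂P
  have hVab : ∀ κ, (fun s => Va κ s * Vb κ s) =ᵐ[P] fun s => a κ s * b κ s := fun κ => by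
    filter_upwards [hVa, hVb] with s h1 h2
    rw [h1, h2]
  have hprod : ∀ κ, MemLp (fun s => a κ s * b κ s) 2 P := fun κ => by
    have : ENNReal.HolderTriple 4 4 2 := ⟨by
      rw [← two_mul, show (4 : ENNReal) = 2 * 2 by norm_num, ENNReal.mul_inv (by simp) (by simp),
        ← mul_assoc, ENNReal.mul_inv_cancel (by simp) (by simp), one_mul]⟩
    exact (hbL κ).mul' (haL κ)
  have hVm : Measurable (Function.uncurry fun κ s => Va κ s * Vb κ s) := hVam.mul hVbm
  have hμm : Measurable μ := by
    have h1 : μ = fun κ => ∫ s, Va κ s * Vb κ s ∂P :=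
      funext fun κ => integral_congr_ae (hVab κ).symm
    rw [h1]
    exact hVm.stronglyMeasurable.integral_prod_right.measurable
  have hsq : ∀ c : ℝ → Ω → ℂ, (∀ κ ≥ 1, ∀ κ' ≥ 1, ‖∫ s, c κ s * conj (c κ' s) ∂P‖ ≤
      C * κ' ^ (-m) * ((1 + |κ - κ'|) ^ 3)⁻¹) → ∀ κ ≥ 1, ∫ s, ‖c κ s‖ ^ 2 ∂P ≤ C * κ ^ (-m) :=
    fun c hc κ hκ => by
      have h := hc κ hκ κ hκ
      have h2 : ∫ s, c κ s * conj (c κ s) ∂P = ((∫ s, ‖c κ s‖ ^ 2 ∂P : ℝ) : ℂ) := by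
        rw [← integral_complex_ofReal]
        simp_rw [Complex.mul_conj, Complex.normSq_eq_norm_sq]
      rw [h2, Complex.norm_real, Real.norm_eq_abs] at h
      simpa using (le_abs_self _).trans h
  have hμb : ∀ κ ≥ 1, ‖(w κ : ℂ) * μ κ‖ ≤ (1 + τ) * C := fun κ hκ => by
    have i1 := ((haL κ).mono_exponent (by norm_num : (2 : ENNReal) ≤ 4)).integrable_norm_pow
      (by norm_num)
    have i2 := ((hbL κ).mono_exponent (by norm_num : (2 : ENNReal) ≤ 4)).integrable_norm_pow
      (by norm_num)
    have h1 : ‖μ κ‖ ≤ C * κ ^ (-m) := by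
      calc ‖μ κ‖ ≤ ∫ s, (‖a κ s‖ ^ 2 + ‖b κ s‖ ^ 2) / 2 ∂P := by
            refine norm_integral_le_of_norm_le ((i1.add i2).div_const 2) (ae_of_all _ fun s => ?_)
            rw [norm_mul]
            nlinarith [sq_nonneg (‖a κ s‖ - ‖b κ s‖)]
        _ ≤ C * κ ^ (-m) := by
            have e := integral_add i1 i2
            simp only [integral_div]
            have h1 := hsq a haa κ hκ
            have h2 := hsq b hbb κ hκ
            linarith
    have hκ0 : 0 < κ := by linarith
    rw [norm_mul, Complex.norm_real, Real.norm_eq_abs, abs_of_nonneg (hw0 κ hκ)]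
    calc w κ * ‖μ κ‖ ≤ (κ ^ m * (1 + τ)) * (C * κ ^ (-m)) := by
          gcongr
          exact hw1 κ hκ
      _ = (1 + τ) * C := by
          rw [Real.rpow_neg hκ0.le]
          field_simp
  have hμi : ∀ Q ≥ 1, IntervalIntegrable (fun κ => (w κ : ℂ) * μ κ) volume 1 Q := fun Q hQ => by
    rw [intervalIntegrable_iff, uIoc_of_le hQ]
    refine (integrableOn_const (C := (1 + τ) * C) (by simp)).mono'
      ((Complex.measurable_ofReal.comp hwm).mul hμm).aestronglyMeasurable ?_
    filter_upwards [ae_restrict_mem measurableSet_Ioc] with κ hκ using hμb κ hκ.1.le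
  -- The weighted fluctuation about the mean, built from the jointly measurable modifications.
  let X : ℝ → Ω → ℂ := fun κ s => (w κ : ℂ) * (Va κ s * Vb κ s) - (w κ : ℂ) * μ κ
  have hXm : Measurable (Function.uncurry X) := by
    refine Measurable.sub (Measurable.mul ?_ hVm) ?_
    · exact Complex.measurable_ofReal.comp (hwm.comp measurable_fst)
    · exact (Complex.measurable_ofReal.comp (hwm.comp measurable_fst)).mul (hμm.comp measurable_fst)
  have hXae : ∀ κ, X κ =ᵐ[P] fun s => (w κ : ℂ) * (a κ s * b κ s - μ κ) := fun κ => by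
    filter_upwards [hVab κ] with s hs
    simp only [X]
    rw [hs]; ring
  have hXL : ∀ κ ≥ 1, MemLp (X κ) 2 P := fun κ _ =>
    (((hprod κ).sub (memLp_const (μ κ))).const_mul (w κ : ℂ)).ae_eq (hXae κ).symm
  -- Of the three Wick pairings of a, b, ā', b̄', centering cancels the one joining a to b; the
  -- other two each join κ to κ'.
  have hcov : ∀ κ κ', ∫ s, (a κ s * b κ s - μ κ) * conj (a κ' s * b κ' s - μ κ') ∂P =
      (∫ s, a κ s * conj (a κ' s) ∂P) * (∫ s, b κ s * conj (b κ' s) ∂P) +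
      (∫ s, a κ s * conj (b κ' s) ∂P) * (∫ s, b κ s * conj (a κ' s) ∂P) := fun κ κ' => by
    have hwick := wick_complex hR (Z := ![a κ, b κ, fun s => conj (a κ' s), fun s => conj (b κ' s)])
      (fun i => by
        fin_cases i
        · exact ha κ
        · exact hb κ
        · exact ha' κ'
        · exact hb' κ')
    simp only [wickDefect, Matrix.cons_val_zero, Matrix.cons_val_one, Matrix.cons_val] at hwick
    have hconj : ∫ s, conj (a κ' s) * conj (b κ' s) ∂P = conj (μ κ') := by
      simp_rw [← map_mul]; exact integral_conj
    rw [hconj, sub_eq_zero] at hwick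
    have j1 : Integrable (fun s => a κ s * b κ s * conj (a κ' s) * conj (b κ' s)) P :=
      integrable_mul_four (haL κ) (hbL κ) (haL κ').star (hbL κ').star
    have j2 : Integrable (fun s => a κ s * b κ s) P := (hprod κ).integrable (by norm_num)
    have j3 : Integrable (fun s => conj (a κ' s) * conj (b κ' s)) P := by
      have := (hprod κ').star.integrable (by norm_num)
      refine this.congr (ae_of_all _ fun s => ?_)
      simp
    have hexp : ∀ s, (a κ s * b κ s - μ κ) * conj (a κ' s * b κ' s - μ κ') =
        (a κ s * b κ s * conj (a κ' s) * conj (b κ' s) - conj (μ κ') * (a κ s * b κ s)) -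
        (μ κ * (conj (a κ' s) * conj (b κ' s)) - μ κ * conj (μ κ')) := fun s => by
      simp only [map_sub, map_mul]; ring
    simp_rw [hexp]
    have k1 : Integrable (fun s => a κ s * b κ s * conj (a κ' s) * conj (b κ' s) -
        conj (μ κ') * (a κ s * b κ s)) P := j1.sub (j2.const_mul _)
    have k2 : Integrable (fun s => μ κ * (conj (a κ' s) * conj (b κ' s)) -
        μ κ * conj (μ κ')) P := (j3.const_mul _).sub (integrable_const _)
    rw [integral_sub k1 k2,
      integral_sub j1 (j2.const_mul _), integral_sub (j3.const_mul _) (integrable_const _),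
      integral_const_mul, integral_const_mul, hconj, hwick, integral_const]
    simp only [probReal_univ, one_smul]
    change _ = _
    simp only [μ]
    ring
  have hXC : ∀ κ ≥ 1, ∀ κ' ≥ 1, ‖∫ s, X κ s * conj (X κ' s) ∂P‖ ≤
      ((1 + τ) ^ 2 * (2 * C ^ 2)) * (1 + (κ - κ') ^ 2)⁻¹ := fun κ hκ κ' hκ' => by
    have hκ0 : 0 < κ := by linarith
    have hκ0' : 0 < κ' := by linarith
    have h1 : ∫ s, X κ s * conj (X κ' s) ∂P = ((w κ * w κ' : ℝ) : ℂ) *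
        ∫ s, (a κ s * b κ s - μ κ) * conj (a κ' s * b κ' s - μ κ') ∂P := by
      rw [← integral_const_mul]
      refine integral_congr_ae ?_
      filter_upwards [hXae κ, hXae κ'] with s h1 h2
      rw [h1, h2, map_mul, Complex.conj_ofReal]
      push_cast; ring
    rw [h1, hcov, norm_mul, Complex.norm_real, Real.norm_eq_abs,
      abs_of_nonneg (mul_nonneg (hw0 κ hκ) (hw0 κ' hκ'))]
    set d := 1 + |κ - κ'| with hd
    have hd1 : 1 ≤ d := by linarith [abs_nonneg (κ - κ')]
    have h2 : ‖(∫ s, a κ s * conj (a κ' s) ∂P) * (∫ s, b κ s * conj (b κ' s) ∂P) +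
        (∫ s, a κ s * conj (b κ' s) ∂P) * (∫ s, b κ s * conj (a κ' s) ∂P)‖ ≤
        2 * (C * κ' ^ (-m) * (d ^ 3)⁻¹) ^ 2 := by
      refine (norm_add_le _ _).trans ?_
      rw [norm_mul, norm_mul, two_mul, sq]
      gcongr
      · exact haa κ hκ κ' hκ'
      · exact hbb κ hκ κ' hκ'
      · exact hab κ hκ κ' hκ'
      · exact hba κ hκ κ' hκ'
    -- Comparing κ^m with κ'^m costs d³. The product of two correlations supplies d⁻⁶, and the
    -- remaining d⁻³ is below the (1 + (κ - κ')²)⁻¹ required by the law of large numbers.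
    have h3 : w κ ≤ κ' ^ m * d ^ 3 * (1 + τ) :=
      (hw1 κ hκ).trans (by gcongr; exact rpow_le_rpow_mul_pow hm hκ hκ')
    have h4 : (d ^ 3)⁻¹ ≤ (1 + (κ - κ') ^ 2)⁻¹ := by
      refine inv_anti₀ (by positivity) ?_
      calc 1 + (κ - κ') ^ 2 ≤ d ^ 2 := by
            rw [hd, ← sq_abs (κ - κ')]; nlinarith [abs_nonneg (κ - κ')]
        _ ≤ d ^ 3 := pow_le_pow_right₀ hd1 (by norm_num)
    calc w κ * w κ' * _ ≤ (κ' ^ m * d ^ 3 * (1 + τ)) * (κ' ^ m * (1 + τ)) *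
          (2 * (C * κ' ^ (-m) * (d ^ 3)⁻¹) ^ 2) := by
          have := hw0 κ hκ
          have := hw0 κ' hκ'
          gcongr
          exact hw1 κ' hκ'
      _ = ((1 + τ) ^ 2 * (2 * C ^ 2)) * (d ^ 3)⁻¹ := by
          rw [Real.rpow_neg hκ0'.le]
          field_simp
      _ ≤ _ := by gcongr
  have hVi : ∀ s, ∀ Q ≥ 1, IntervalIntegrable (fun κ => (w κ : ℂ) * (Va κ s * Vb κ s))
      volume 1 Q := fun s Q hQ => by
    refine ContinuousOn.intervalIntegrable ?_
    rw [uIcc_of_le hQ]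
    refine ContinuousOn.mul ?_ ((hVac s).mul (hVbc s)).continuousOn
    exact Complex.continuous_ofReal.comp_continuousOn (hwc.mono Icc_subset_Ici_self)
  have hXi : ∀ s, ∀ Q ≥ 1, IntervalIntegrable (fun κ => X κ s) volume 1 Q := fun s Q hQ =>
    (hVi s Q hQ).sub (hμi Q hQ)
  have hmean : Tendsto (fun κ => (w κ : ℂ) * μ κ) atTop (𝓝 L) := by
    have h1 : Tendsto (fun κ : ℝ => ((1 + τ * κ⁻¹ : ℝ) : ℂ)) atTop (𝓝 1) := by
      have := ((tendsto_inv_atTop_zero (𝕜 := ℝ)).const_mul τ).const_add 1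
      have := (Complex.continuous_ofReal.tendsto _).comp this
      simp only [mul_zero, add_zero, Complex.ofReal_one] at this
      exact this
    have h2 := h1.mul hL
    rw [one_mul] at h2
    refine h2.congr' ?_
    filter_upwards [eventually_ge_atTop 1] with κ hκ
    rw [hw κ hκ]; push_cast; ring
  have hmeanavg := tendsto_average_of_tendsto hmean hμi
  filter_upwards [ae_tendsto_average hXm hXL hXC (ae_of_all _ hXi), hVa, hVb] with s hs h1 h2
  -- The average over [Q, 2Q] is twice the average up to 2Q minus the average up to Q.
  have h3 : Tendsto (fun Q : ℝ => ((1 / Q : ℝ) : ℂ) * ∫ κ in Q..(2 * Q), X κ s) atTop (𝓝 0) := by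
    have h4 := ((hs.comp (tendsto_id.const_mul_atTop (zero_lt_two' ℝ))).const_mul 2).sub hs
    rw [mul_zero, sub_zero] at h4
    refine h4.congr' ?_
    filter_upwards [eventually_ge_atTop 1] with Q hQ
    have hQ0 : (Q : ℂ) ≠ 0 := by exact_mod_cast (by linarith : Q ≠ 0)
    rw [← intervalIntegral.integral_interval_sub_left (hXi s (2 * Q) (by linarith)) (hXi s Q hQ)]
    simp only [Function.comp_apply, id]
    push_cast
    field_simp
  have h4 := h3.add hmeanavg
  rw [zero_add] at h4
  refine h4.congr' ?_
  filter_upwards [eventually_ge_atTop 1] with Q hQ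
  have e1 : IntervalIntegrable (fun κ => X κ s) volume Q (2 * Q) :=
    (hXi s Q hQ).symm.trans (hXi s _ (by linarith))
  have e2 : IntervalIntegrable (fun κ => (w κ : ℂ) * μ κ) volume Q (2 * Q) :=
    (hμi Q hQ).symm.trans (hμi _ (by linarith))
  rw [← mul_add, ← intervalIntegral.integral_add e1 e2]
  congr 1
  refine intervalIntegral.integral_congr fun κ _ => ?_
  simp only [X, w, h1, h2]
  ring

end GaussianAverage

/-! ### Plane waves as test functions and the second moments of the field. -/

/-- The test function `χ(y) e^{-i ξ·y}` in the `j`-th component. -/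
def wave (χ : E3 → ℂ) (ξ : E3) (j : Fin 3) : VecTest :=
  toTest fun y => Pi.single j (χ y * Complex.exp (-(Complex.I * (inner ℝ ξ y : ℝ))))

theorem contDiff_wave {χ : E3 → ℂ} (hχ : ContDiff ℝ ∞ χ) (ξ : E3) :
    ContDiff ℝ ∞ fun y => χ y * Complex.exp (-(Complex.I * (inner ℝ ξ y : ℝ))) :=
  hχ.mul (ContDiff.cexp (contDiff_const.mul (Complex.ofRealCLM.contDiff.comp
    (contDiff_const.inner ℝ contDiff_id))).neg)

theorem wave_apply {χ : E3 → ℂ} (hχ : ContDiff ℝ ∞ χ) (hχc : HasCompactSupport χ) (ξ : E3)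
    (j : Fin 3) (y : E3) : wave χ ξ j y =
      Pi.single j (χ y * Complex.exp (-(Complex.I * (inner ℝ ξ y : ℝ)))) := by
  exact congrFun (toTest_coe ((contDiff_piSingle j).comp (contDiff_wave hχ ξ))
    (hasCompactSupport_single hχc j)) y

theorem pair_exp_eq (χ : E3 → ℂ) (u : VecDist) (κ : ℝ) (x : E3) (j : Fin 3) :
    pair χ u (fun y => Complex.exp (-(Complex.I * κ * (inner ℝ x y : ℝ)))) j =
      u (wave χ (κ • x) j) := by
  unfold pair wave
  congr 3
  ext y : 1
  rw [inner_smul_left]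
  simp [mul_assoc]

theorem farField_eq (χ : E3 → ℂ) (u : VecDist) (x : E3) (κ : ℝ) (j : Fin 3) :
    farField χ u x κ j = Complex.I * κ * (1 / (4 * Real.pi)) * u (wave χ (κ • x) j) := by
  rw [farField, pair_exp_eq]

theorem continuous_wave_smul {χ : E3 → ℂ} (hχ : ContDiff ℝ ∞ χ) (hχc : HasCompactSupport χ)
    (u : VecDist) (x : E3) (j : Fin 3) : Continuous fun κ : ℝ => u (wave χ (κ • x) j) := by
  simp_rw [← pair_exp_eq]
  refine continuous_pair hχc ?_ u j
  refine (hχ.comp contDiff_snd).mul (ContDiff.cexp (ContDiff.neg ?_))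
  have hof : ContDiff ℝ ∞ (fun t : ℝ => (t : ℂ)) := Complex.ofRealCLM.contDiff
  exact (contDiff_const.mul (hof.comp contDiff_fst)).mul
    (hof.comp (contDiff_const.inner ℝ contDiff_snd))

/-- This identifies the first argument for which `covForm` yields E[conj f(`wave χ η l`) f(ψ)]. -/
theorem conjTest_wave {χ : E3 → ℂ} (hχ : ContDiff ℝ ∞ χ) (hχc : HasCompactSupport χ) (η : E3)
    (l : Fin 3) : conjTest (wave (fun y => conj (χ y)) (-η) l) = wave χ η l := by
  have hχ' : ContDiff ℝ ∞ fun y => conj (χ y) := Complex.conjCLE.contDiff.comp hχ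
  have hχc' : HasCompactSupport fun y => conj (χ y) := hχc.comp_left (map_zero _)
  ext y j
  rw [conjTest_apply, wave_apply hχ' hχc', wave_apply hχ hχc]
  by_cases h : j = l
  · subst h
    simp [← Complex.exp_conj]
  · simp [h]

theorem fourier_mul_exp (θ : E3 → ℂ) (η ξ : E3) :
    fourier (fun y => θ y * Complex.exp (-(Complex.I * (inner ℝ (-η) y : ℝ)))) ξ =
      fourier θ (ξ - η) := by
  unfold fourier
  refine integral_congr_ae (ae_of_all _ fun y => ?_)
  simp only [inner_neg_left, inner_sub_right]
  rw [mul_left_comm, ← Complex.exp_add, mul_comm, real_inner_comm y η]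
  congr 2
  push_cast; ring

/-- The symbol is supported in D in x, so the outer cut-off χ is 1 there and disappears. The inner
cut-off θ enters through its Fourier transform shifted by η and must be kept. -/
theorem integral_pseudoDiff_wave {S : E3 → E3 → Matrix (Fin 3) (Fin 3) ℂ} {D : Set E3}
    {χ θ : E3 → ℂ} (hS : ∀ ξ, IsTestMatOn D fun x => S x ξ) (hχ : ContDiff ℝ ∞ χ)
    (hχc : HasCompactSupport χ) (hχD : ∀ x ∈ D, χ x = 1) (hθ : ContDiff ℝ ∞ θ)
    (hθc : HasCompactSupport θ) (ξ η : E3) (j l : Fin 3) :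
    ∫ x, ∑ i, pseudoDiff S (wave θ (-η) l) x i * wave χ ξ j x i =
      kern (fun x ξ => S x ξ j l) θ ξ η := by
  have hφ : ∀ i ξ', fourier (fun y => wave θ (-η) l y i) ξ' =
      if i = l then fourier θ (ξ' - η) else 0 := fun i ξ' => by
    simp_rw [wave_apply hθ hθc]
    by_cases h : i = l
    · subst h
      simp only [Pi.single_eq_same, if_true]
      exact fourier_mul_exp θ η ξ'
    · simp [h, fourier]
  have hp : ∀ x i, pseudoDiff S (wave θ (-η) l) x i = ((1 / (2 * Real.pi) ^ 3 : ℝ) : ℂ) *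
      ∫ ξ', Complex.exp (Complex.I * (inner ℝ x ξ' : ℝ)) *
        (S x ξ' i l * fourier θ (ξ' - η)) := fun x i => by
    simp only [pseudoDiff, hφ]
    simp
  rw [kern, ← integral_const_mul]
  refine integral_congr_ae (ae_of_all _ fun x => ?_)
  simp only [wave_apply hχ hχc, hp]
  rw [Finset.sum_eq_single j (fun i _ hi => by simp [hi]) (by simp)]
  rw [Pi.single_eq_same, mul_assoc, ← integral_mul_const]
  congr 1
  refine integral_congr_ae (ae_of_all _ fun ξ' => ?_)
  simp only
  by_cases hx : x ∈ D
  · rw [hχD x hx, one_mul, mul_right_comm, ← Complex.exp_add, inner_sub_right, real_inner_comm ξ x]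
    congr 2
    push_cast; ring
  · simp [(hS ξ' j l).eq_zero hx]

theorem exists_matrix_kern_le {m : ℝ} (hm : |m| ≤ 3) {S : E3 → E3 → Matrix (Fin 3) (Fin 3) ℂ}
    {D : Set E3} (hD : IsOpen D) (hDb : Bornology.IsBounded D) {A : MatField}
    (hS : IsIsotropicSymbol D m S A) {θ : E3 → ℂ} (hθ : ContDiff ℝ ∞ θ)
    (hθc : HasCompactSupport θ) : ∃ C : ℝ, 0 ≤ C ∧ ∀ j l, ∀ ξ η : E3,
      ‖kern (fun x ξ => S x ξ j l) θ ξ η‖ ≤ C * (1 + ‖η‖) ^ (-m) * ((1 + ‖ξ - η‖) ^ 3)⁻¹ := by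
  choose C hC0 hC using fun j l => exists_kern_le (hS.2.1 j l) (by rwa [abs_neg]) hD hDb
    (fun ξ => hS.2.2.1 ξ j l) hθ hθc 3
  refine ⟨∑ j, ∑ l, C j l, Finset.sum_nonneg fun j _ => Finset.sum_nonneg fun l _ => hC0 j l,
    fun j l ξ η => (hC j l ξ η).trans ?_⟩
  gcongr
  exact (Finset.single_le_sum (f := fun l => C j l) (fun l _ => hC0 j l) (Finset.mem_univ l)).trans
    (Finset.single_le_sum (f := fun j => ∑ l, C j l)
      (fun j _ => Finset.sum_nonneg fun l _ => hC0 j l) (Finset.mem_univ j))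

/-- Here α and β are the signed frequencies of the two factors, possibly shifted by τ. Peetre's
inequality with c = 1 + τ replaces (1 + |β|)^{-m} by κ'^{-m} at the cost (2 + τ)³. -/
theorem weight_le {m : ℝ} (hm : |m| ≤ 3) {e : E3} (he : ‖e‖ = 1) {C τ κ κ' α β : ℝ} (hC : 0 ≤ C)
    (hκ' : 1 ≤ κ') (h1 : κ' ≤ |β|) (h2 : |β| ≤ κ' + τ) (hd : |κ - κ'| ≤ |α - β|) :
    C * (1 + ‖β • e‖) ^ (-m) * ((1 + ‖α • e - β • e‖) ^ 3)⁻¹ ≤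
      C * (2 + τ) ^ 3 * κ' ^ (-m) * ((1 + |κ - κ'|) ^ 3)⁻¹ := by
  have h := peetre (a := |β|) (b := κ' - 1) (c := 1 + τ) (s := -m) (k := 3) (abs_nonneg _)
    (by linarith) (by linarith) (by linarith) (by linarith) (by rw [abs_neg]; exact_mod_cast hm)
  rw [add_sub_cancel, ← add_assoc, one_add_one_eq_two] at h
  have hτ : 0 ≤ τ := by linarith
  rw [← sub_smul, norm_smul, norm_smul, he, mul_one, mul_one, Real.norm_eq_abs, Real.norm_eq_abs]
  calc C * (1 + |β|) ^ (-m) * ((1 + |α - β|) ^ 3)⁻¹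
      ≤ C * (κ' ^ (-m) * (2 + τ) ^ 3) * ((1 + |κ - κ'|) ^ 3)⁻¹ := by gcongr
    _ = _ := by ring

/-! ### Almost sure limits of the averages and uniqueness. -/

section Main

variable {Ω : Type*} [MeasurableSpace Ω] {P : Measure Ω} {D : Set E3} {m : ℝ} {f : Ω → VecDist}
  {Ac Ar : MatField} {χ : E3 → ℂ}

theorem IsCutoff.eq_one (hχ : IsCutoff D χ) : ∀ x ∈ D, χ x = 1 := fun _ hx =>
  hχ.2.2.self_of_nhdsSet _ (subset_closure hx)

theorem IsIsotropicSymbol.exists_entry {S : E3 → E3 → Matrix (Fin 3) (Fin 3) ℂ} {A : MatField}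
    (hS : IsIsotropicSymbol D m S A) (j l : Fin 3) : ∃ ρ : E3 → E3 → ℂ, IsSymbol (-m - 1) ρ ∧
      ∀ x ξ, 1 ≤ ‖ξ‖ → S x ξ j l = ((‖ξ‖ ^ (-m) : ℝ) : ℂ) * A x j l + ρ x ξ := by
  obtain ⟨-, -, -, R, hR, -, h⟩ := hS
  exact ⟨fun x ξ => R x ξ j l, hR j l, fun x ξ hξ => by rw [h x ξ hξ]; simp⟩

/-- The correlations of the Fourier coefficients of the source. -/
theorem exists_correlations (hD : IsOpen D) (hDb : Bornology.IsBounded D) (hm : |m| ≤ 3)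
    (hf : IsCenteredGMIG P D m f Ac Ar) (hχ : IsCutoff D χ) :
    ∃ Kc Kr : Fin 3 → Fin 3 → E3 → E3 → ℂ,
      (∀ j l ξ η, ∫ s, f s (wave χ ξ j) * conj (f s (wave χ η l)) ∂P = Kc j l ξ η) ∧
      (∀ j l ξ η, ∫ s, f s (wave χ ξ j) * f s (wave χ (-η) l) ∂P = Kr j l ξ η) ∧
      (∃ C : ℝ, 0 ≤ C ∧ ∀ j l, ∀ ξ η : E3,
        ‖Kc j l ξ η‖ ≤ C * (1 + ‖η‖) ^ (-m) * ((1 + ‖ξ - η‖) ^ 3)⁻¹ ∧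
        ‖Kr j l ξ η‖ ≤ C * (1 + ‖η‖) ^ (-m) * ((1 + ‖ξ - η‖) ^ 3)⁻¹) ∧
      ∀ j l, ∀ e : E3, ‖e‖ = 1 → ∀ τ : ℝ,
        Tendsto (fun κ : ℝ => ((κ ^ m : ℝ) : ℂ) * Kc j l ((κ + τ) • e) (κ • e)) atTop
          (𝓝 (fourier (fun y => Ac y j l) (τ • e))) ∧
        Tendsto (fun κ : ℝ => ((κ ^ m : ℝ) : ℂ) * Kr j l ((κ + τ) • e) (κ • e)) atTop
          (𝓝 (fourier (fun y => Ar y j l) (τ • e))) := by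
  obtain ⟨Sc, hSc, hc⟩ := hf.covariance
  obtain ⟨Sr, hSr, hr⟩ := hf.relation
  have hχ' : ContDiff ℝ ∞ fun y => conj (χ y) := Complex.conjCLE.contDiff.comp hχ.1
  have hχc' : HasCompactSupport fun y => conj (χ y) := hχ.2.1.comp_left (map_zero _)
  have hχ1' : ∀ x ∈ D, conj (χ x) = 1 := fun x hx => by rw [hχ.eq_one x hx, map_one]
  -- The covariance form conjugates its first argument, so its inner cut-off is the conjugate of χ;
  -- the relation form keeps χ.
  refine ⟨fun j l => kern (fun x ξ => Sc x ξ j l) fun y => conj (χ y),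
    fun j l => kern (fun x ξ => Sr x ξ j l) χ, fun j l ξ η => ?_, fun j l ξ η => ?_, ?_,
    fun j l e he τ => ⟨?_, ?_⟩⟩
  · have h := integral_pseudoDiff_wave hSc.2.2.1 hχ.1 hχ.2.1 hχ.eq_one hχ' hχc' ξ η j l
    rw [← hc, covForm, conjTest_wave hχ.1 hχ.2.1] at h
    exact (integral_congr_ae (ae_of_all _ fun s => mul_comm _ _)).trans h
  · have h := integral_pseudoDiff_wave hSr.2.2.1 hχ.1 hχ.2.1 hχ.eq_one hχ.1 hχ.2.1 ξ η j l
    rw [← hr, relForm] at h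
    exact (integral_congr_ae (ae_of_all _ fun s => mul_comm _ _)).trans h
  · obtain ⟨C, hC0, hC⟩ := exists_matrix_kern_le hm hD hDb hSc hχ' hχc'
    obtain ⟨C', hC0', hC'⟩ := exists_matrix_kern_le hm hD hDb hSr hχ.1 hχ.2.1
    refine ⟨C + C', by positivity, fun j l ξ η => ⟨(hC j l ξ η).trans ?_, (hC' j l ξ η).trans ?_⟩⟩
    · gcongr; linarith
    · gcongr; linarith
  · obtain ⟨ρ, hρ, h⟩ := hSc.exists_entry j l
    exact tendsto_kern hm (hSc.2.1 j l) hρ h hD hDb (hSc.1 j l) (fun ξ => hSc.2.2.1 ξ j l) hχ' hχc'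
      hχ1' he τ
  · obtain ⟨ρ, hρ, h⟩ := hSr.exists_entry j l
    exact tendsto_kern hm (hSr.2.1 j l) hρ h hD hDb (hSr.1 j l) (fun ξ => hSr.2.2.1 ξ j l) hχ.1
      hχ.2.1 hχ.eq_one he τ

theorem norm_integral_conj_symm {X Y : Ω → ℂ} :
    ‖∫ s, conj (X s) * Y s ∂P‖ = ‖∫ s, X s * conj (Y s) ∂P‖ := by
  rw [← RCLike.norm_conj, ← integral_conj]
  simp

/-- Almost sure convergence of the frequency averages of the far-field correlations. -/
theorem ae_averages_tendsto [IsProbabilityMeasure P] (hD : IsOpen D) (hDb : Bornology.IsBounded D)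
    (hm : |m| ≤ 3) (hf : IsCenteredGMIG P D m f Ac Ar) (hχ : IsCutoff D χ) {e : E3} (he : ‖e‖ = 1)
    {τ : ℝ} (hτ : 0 ≤ τ) :
    ∀ᵐ s ∂P, CovAverageTendsto χ m (f s) τ e Ac ∧ RelAverageTendsto χ m (f s) τ e Ar := by
  obtain ⟨Kc, Kr, hKc, hKr, ⟨C, hC0, hC⟩, hlim⟩ := exists_correlations hD hDb hm hf hχ
  have hR := hf.realParts_gaussian
  have hC0' : 0 ≤ C * (2 + τ) ^ 3 := by positivity
  have hcont : ∀ s j, Continuous fun κ : ℝ => f s (wave χ (κ • e) j) := fun s j =>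
    continuous_wave_smul hχ.1 hχ.2.1 (f s) e j
  have hKcb : ∀ {κ κ' α β : ℝ} (j l : Fin 3), 1 ≤ κ' → κ' ≤ |β| → |β| ≤ κ' + τ →
      |κ - κ'| ≤ |α - β| → ‖∫ s, f s (wave χ (α • e) j) * conj (f s (wave χ (β • e) l)) ∂P‖ ≤
        C * (2 + τ) ^ 3 * κ' ^ (-m) * ((1 + |κ - κ'|) ^ 3)⁻¹ :=
    fun j l h' h1 h2 h3 => by
      rw [hKc]
      exact (hC j l _ _).1.trans (weight_le hm he hC0 h' h1 h2 h3)
  have hKrb : ∀ {κ κ' α β : ℝ} (j l : Fin 3), 1 ≤ κ' → κ' ≤ |β| → |β| ≤ κ' + τ →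
      |κ - κ'| ≤ |α + β| → ‖∫ s, f s (wave χ (α • e) j) * f s (wave χ (β • e) l) ∂P‖ ≤
        C * (2 + τ) ^ 3 * κ' ^ (-m) * ((1 + |κ - κ'|) ^ 3)⁻¹ :=
    fun {κ κ' α β} j l h' h1 h2 h3 => by
      have := hKr j l (α • e) ((-β) • e)
      rw [neg_smul, neg_neg] at this
      rw [this, ← neg_smul]
      exact (hC j l _ _).2.trans (weight_le hm he hC0 h' (by rwa [abs_neg]) (by rwa [abs_neg])
        (by rwa [sub_neg_eq_add]))
  -- The mixed correlations depend on the sum of the two frequencies rather than their difference.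
  -- As κ, κ' ≥ 1, they decay at least as fast in |κ - κ'|.
  have hsum : ∀ {κ κ' : ℝ}, 1 ≤ κ → 1 ≤ κ' → |κ - κ'| ≤ κ + κ' := fun h h' =>
    abs_le.2 ⟨by linarith, by linarith⟩
  have hcov : ∀ j l, ∀ᵐ s ∂P, Tendsto (fun Q : ℝ => ((1 / Q : ℝ) : ℂ) * ∫ κ in Q..(2 * Q),
      ((κ ^ (m - 2) * ((κ + τ) * κ) : ℝ) : ℂ) *
        (f s (wave χ ((κ + τ) • e) j) * conj (f s (wave χ (κ • e) l)))) atTop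
      (𝓝 (fourier (fun y => Ac y j l) (τ • e))) := fun j l => by
    refine ae_tendsto_gaussian_average hR hm hτ (a := fun κ s => f s (wave χ ((κ + τ) • e) j))
      (b := fun κ s => conj (f s (wave χ (κ • e) l)))
      (fun κ => re_im_mem_realParts _) (fun κ => re_im_conj_mem_realParts _)
      (fun κ => re_im_conj_mem_realParts _)
      (fun κ => by simpa only [Complex.conj_conj] using re_im_mem_realParts (f := f) _)
      (fun s => (hcont s j).comp (continuous_add_const τ))
      (fun s => Complex.continuous_conj.comp (hcont s l)) hC0' ?_ ?_ ?_ ?_ ?_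
    · intro κ hκ κ' hκ'
      refine hKcb j j hκ' ?_ ?_ ?_
      · rw [abs_of_nonneg (by linarith)]; linarith
      · rw [abs_of_nonneg (by linarith)]
      · rw [add_sub_add_right_eq_sub]
    · intro κ hκ κ' hκ'
      simp only [Complex.conj_conj]
      rw [norm_integral_conj_symm]
      refine hKcb l l hκ' ?_ ?_ le_rfl
      · exact le_abs_self _
      · rw [abs_of_nonneg (by linarith)]; linarith
    · intro κ hκ κ' hκ'
      simp only [Complex.conj_conj]
      refine hKrb j l hκ' ?_ ?_ ?_
      · exact le_abs_self _
      · rw [abs_of_nonneg (by linarith)]; linarith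
      · exact (hsum hκ hκ').trans (le_trans (by linarith) (le_abs_self _))
    · intro κ hκ κ' hκ'
      rw [norm_integral_conj_symm]
      simp only [Complex.conj_conj]
      refine hKrb l j hκ' ?_ ?_ ?_
      · rw [abs_of_nonneg (by linarith)]; linarith
      · rw [abs_of_nonneg (by linarith)]
      · exact (hsum hκ hκ').trans (le_trans (by linarith) (le_abs_self _))
    · simp_rw [hKc]
      exact (hlim j l e he τ).1
  have hrel : ∀ j l, ∀ᵐ s ∂P, Tendsto (fun Q : ℝ => ((1 / Q : ℝ) : ℂ) * ∫ κ in Q..(2 * Q),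
      ((κ ^ (m - 2) * ((κ + τ) * κ) : ℝ) : ℂ) *
        (f s (wave χ ((κ + τ) • e) j) * f s (wave χ ((-κ) • e) l))) atTop
      (𝓝 (fourier (fun y => Ar y j l) (τ • e))) := fun j l => by
    refine ae_tendsto_gaussian_average hR hm hτ (a := fun κ s => f s (wave χ ((κ + τ) • e) j))
      (b := fun κ s => f s (wave χ ((-κ) • e) l))
      (fun κ => re_im_mem_realParts _) (fun κ => re_im_mem_realParts _)
      (fun κ => re_im_conj_mem_realParts _) (fun κ => re_im_conj_mem_realParts _)
      (fun s => (hcont s j).comp (continuous_add_const τ))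
      (fun s => (hcont s l).comp continuous_neg) hC0' ?_ ?_ ?_ ?_ ?_
    · intro κ hκ κ' hκ'
      refine hKcb j j hκ' ?_ ?_ ?_
      · rw [abs_of_nonneg (by linarith)]; linarith
      · rw [abs_of_nonneg (by linarith)]
      · rw [add_sub_add_right_eq_sub]
    · intro κ hκ κ' hκ'
      refine hKcb l l hκ' ?_ ?_ ?_
      · rw [abs_neg]; exact le_abs_self _
      · rw [abs_neg, abs_of_nonneg (by linarith)]; linarith
      · rw [neg_sub_neg, abs_sub_comm]
    · intro κ hκ κ' hκ'
      refine hKcb j l hκ' ?_ ?_ ?_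
      · rw [abs_neg]; exact le_abs_self _
      · rw [abs_neg, abs_of_nonneg (by linarith)]; linarith
      · rw [sub_neg_eq_add]; exact (hsum hκ hκ').trans (le_trans (by linarith) (le_abs_self _))
    · intro κ hκ κ' hκ'
      refine hKcb l j hκ' ?_ ?_ ?_
      · rw [abs_of_nonneg (by linarith)]; linarith
      · rw [abs_of_nonneg (by linarith)]
      · exact (hsum hκ hκ').trans (le_trans (by linarith) (neg_le_abs _))
    · simp_rw [neg_smul, hKr]
      exact (hlim j l e he τ).2
  have hpi : (Real.pi : ℂ) ≠ 0 := by exact_mod_cast Real.pi_ne_zero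
  filter_upwards [ae_all_iff.2 fun j => ae_all_iff.2 fun l => hcov j l,
    ae_all_iff.2 fun j => ae_all_iff.2 fun l => hrel j l] with s h1 h2
  constructor
  -- The far-field prefactors multiply to κ(κ + τ)/(16π²) times i·(-i) = 1. For the relation average
  -- below, i·i = -1 produces the minus sign.
  · intro j l
    refine ((h1 j l).const_mul (1 / (16 * Real.pi ^ 2 : ℂ))).congr fun Q => ?_
    rw [mul_left_comm, ← intervalIntegral.integral_const_mul]
    congr 1
    refine intervalIntegral.integral_congr fun κ _ => ?_
    simp only [farField_eq, map_mul, map_div₀, map_one, Complex.conj_I, Complex.conj_ofReal,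
      map_ofNat]
    push_cast
    field_simp
    rw [Complex.I_sq]
    ring
  · intro j l
    refine ((h2 j l).const_mul (-(1 / (16 * Real.pi ^ 2 : ℂ)))).congr fun Q => ?_
    rw [mul_left_comm, ← intervalIntegral.integral_const_mul]
    congr 1
    refine intervalIntegral.integral_congr fun κ _ => ?_
    simp only [farField_eq, smul_neg, neg_smul]
    push_cast
    field_simp
    rw [Complex.I_sq]
    ring

theorem eq_of_fourier_eq_polar {A B : MatField} (hA : IsTestMatOn D A) (hB : IsTestMatOn univ B)
    {Θ S : Set (ℝ≥0 × Metric.sphere (0 : E3) 1)} (hΘ : IsOpen Θ) (hne : Θ.Nonempty) (hS : Dense S)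
    (h : ∀ p ∈ Θ ∩ S, ∀ j l, fourier (fun y => B y j l) ((p.1 : ℝ) • (p.2 : E3)) =
      fourier (fun y => A y j l) ((p.1 : ℝ) • (p.2 : E3))) : B = A := by
  ext x j l
  have hBj := hB j l
  have hAj := hA j l
  have h0 := eq_zero_of_fourier_eq_zero_polar (g := fun y => B y j l - A y j l)
    (hBj.1.continuous.sub hAj.1.continuous) (hBj.2.1.sub hAj.2.1) hΘ hne hS fun p hp => by
      have hsub : ∀ ξ, fourier (fun y => B y j l - A y j l) ξ =
          fourier (fun y => B y j l) ξ - fourier (fun y => A y j l) ξ := fun ξ => by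
        have hi : ∀ {g : E3 → ℂ}, Integrable g → Integrable fun x : E3 =>
            Complex.exp (-(Complex.I * (inner ℝ x ξ : ℝ))) * g x := fun hg => by
          refine hg.bdd_mul (c := 1) (Continuous.aestronglyMeasurable (by fun_prop))
            (ae_of_all _ fun x => (norm_exp_neg_I_mul _).le)
        simp only [fourier, mul_sub]
        exact integral_sub (hi hBj.integrable) (hi hAj.integrable)
      rw [hsub, h p hp j l, sub_self]
  exact sub_eq_zero.1 (congrFun h0 x)

theorem CovAverageTendsto.fourier_eq {u : VecDist} {τ : ℝ} {x : E3} {A B : MatField}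
    (hA : CovAverageTendsto χ m u τ x A) (hB : CovAverageTendsto χ m u τ x B) (j l : Fin 3) :
    fourier (fun y => B y j l) (τ • x) = fourier (fun y => A y j l) (τ • x) := by
  have hpi : (Real.pi : ℂ) ≠ 0 := by exact_mod_cast Real.pi_ne_zero
  exact mul_left_cancel₀ (by simp [hpi]) (tendsto_nhds_unique (hB j l) (hA j l))

theorem RelAverageTendsto.fourier_eq {u : VecDist} {τ : ℝ} {x : E3} {A B : MatField}
    (hA : RelAverageTendsto χ m u τ x A) (hB : RelAverageTendsto χ m u τ x B) (j l : Fin 3) :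
    fourier (fun y => B y j l) (τ • x) = fourier (fun y => A y j l) (τ • x) := by
  have hpi : (Real.pi : ℂ) ≠ 0 := by exact_mod_cast Real.pi_ne_zero
  exact mul_left_cancel₀ (by simp [hpi]) (tendsto_nhds_unique (hB j l) (hA j l))

end Main

end EMSource

end

/-! ### Assembly of the theorem. -/

open EMSource in
theorem mainTheorem3 {Ω : Type*} [MeasurableSpace Ω] (P : Measure Ω) [IsProbabilityMeasure P]
    (D : Set E3) (hD : IsOpen D) (hDb : Bornology.IsBounded D)
    (m : ℝ) (hm : -1 < m) (hm' : m ≤ 3)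
    (f : Ω → VecDist) (Ac Ar : MatField) (hf : IsCenteredGMIG P D m f Ac Ar)
    (χ : E3 → ℂ) (hχ : IsCutoff D χ) :
    -- `farField` is the far-field pattern of the electric field
    (∀ (s : Ω) (κ : ℝ), 0 < κ → ∀ (x : Metric.sphere (0 : E3) 1) (j : Fin 3),
      Tendsto (fun r : ℝ => r * Complex.exp (-(Complex.I * κ * r)) *
          electricField χ (f s) κ (r • (x : E3)) j)
        atTop (𝓝 (farField χ (f s) x κ j))) ∧
    -- almost sure limits of the frequency averages
    (∀ (x : Metric.sphere (0 : E3) 1) (τ : ℝ≥0), ∀ᵐ s ∂P,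
      CovAverageTendsto χ m (f s) τ x Ac ∧ RelAverageTendsto χ m (f s) τ x Ar) ∧
    -- the strengths are uniquely determined by the limits with `(τ, x)` in any open set `Θ`
    (∀ Θ : Set (ℝ≥0 × Metric.sphere (0 : E3) 1), IsOpen Θ → Θ.Nonempty →
      (∀ B : MatField, IsTestMatOn univ B →
        ((∀ p ∈ Θ, ∀ᵐ s ∂P, CovAverageTendsto χ m (f s) p.1 p.2 B) → B = Ac) ∧
        ((∀ p ∈ Θ, ∀ᵐ s ∂P, RelAverageTendsto χ m (f s) p.1 p.2 B) → B = Ar)) ∧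
      -- and this from a single realization
      (∀ᵐ s ∂P, ∀ B : MatField, IsTestMatOn univ B →
        ((∀ p ∈ Θ, CovAverageTendsto χ m (f s) p.1 p.2 B) → B = Ac) ∧
        ((∀ p ∈ Θ, RelAverageTendsto χ m (f s) p.1 p.2 B) → B = Ar))) := by
  -- The bound 3 is the integer exponent with which Peetre's inequality is used throughout.
  have hmabs : |m| ≤ 3 := abs_le.2 ⟨by linarith, hm'⟩
  have hAc : IsTestMatOn D Ac := hf.covariance.choose_spec.1.1
  have hAr : IsTestMatOn D Ar := hf.relation.choose_spec.1.1
  have hlim : ∀ p : ℝ≥0 × Metric.sphere (0 : E3) 1, ∀ᵐ s ∂P,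
      CovAverageTendsto χ m (f s) p.1 p.2 Ac ∧ RelAverageTendsto χ m (f s) p.1 p.2 Ar := fun p =>
    ae_averages_tendsto hD hDb hmabs hf hχ (by simp) p.1.2
  refine ⟨fun s κ _ x j => tendsto_electricField hχ.1 hχ.2.1 (f s) κ (by simp) j,
    fun x τ => hlim (τ, x), fun Θ hΘ hne => ⟨fun B hB => ⟨fun h => ?_, fun h => ?_⟩, ?_⟩⟩
  · refine eq_of_fourier_eq_polar hAc hB hΘ hne dense_univ fun p hp j l => ?_
    -- Two almost sure events share a realization, on which the two limits must coincide.
    obtain ⟨s, h1, h2⟩ := ((hlim p).and (h p hp.1)).exists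
    exact h1.1.fourier_eq h2 j l
  · refine eq_of_fourier_eq_polar hAr hB hΘ hne dense_univ fun p hp j l => ?_
    obtain ⟨s, h1, h2⟩ := ((hlim p).and (h p hp.1)).exists
    exact h1.2.fourier_eq h2 j l
  -- Restriction to a countable dense set of parameters leaves a single null set, chosen before B.
  · obtain ⟨S, hSc, hSd⟩ := TopologicalSpace.exists_countable_dense
      (ℝ≥0 × Metric.sphere (0 : E3) 1)
    filter_upwards [(ae_ball_iff hSc).2 fun p _ => hlim p] with s hs B hB
    exact ⟨fun h => eq_of_fourier_eq_polar hAc hB hΘ hne hSd fun p hp j l =>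
        (hs p hp.2).1.fourier_eq (h p hp.1) j l,
      fun h => eq_of_fourier_eq_polar hAr hB hΘ hne hSd fun p hp j l =>
        (hs p hp.2).2.fourier_eq (h p hp.1) j l⟩
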